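/- An edge-colouring of a connected graph $G$ (not necessarily proper) is \emph{strongly rainbow connected} if any two vertices of $G$ are joined by a path of length equal to their distance whose edges have pairwise distinct colours. The \emph{list strong rainbow connection number} $src^\ell(G)$ is the least integer $r\ge 1$ such that, for every assignment $L$ of a set $L(e)\subseteq\mathbb N$ with at least $r$ elements to each edge $e$ of $G$, there is a strongly rainbow connected edge-colouring $c$ of $G$ with $c(e)\in L(e)$ for all edges $e$. For $n\ge 3$, the wheel $W_n$ is the graph on $n+1$ vertices obtained from the cycle $C_n$ by adding a vertex adjacent to all vertices of $C_n$. \textbf{Theorem.} We have \[ src^\ell(W_n)=\begin{cases}1 & \text{if } n=3,\\ 2 & \text{if } n=4,5,6,\\ 3 & \text{if } n=7,8,9.\end{cases} \] For $n\ge 10$, we have \[ \Big\lceil\frac n3\Big\rceil\le src^\ell(W_n)\le \begin{cases} \lceil\frac{4n-3}{9}\rceil & \text{if } n\equiv 0 \pmod 3,\\[0.3ex] \lceil\frac{4n-1}{9}\rceil & \text{if } n\equiv 1 \pmod 3,\\[0.3ex] \lceil\frac{4n+1}{9}\rceil & \text{if } n\equiv 2 \pmod 3. \end{cases} \] -/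

import Mathlib

/-- The wheel on `n + 1` vertices: the cycle on `Fin n` together with one further vertex `none`,
the hub, joined to all vertices of the cycle. -/
def wheelGraph (n : ℕ) : SimpleGraph (Option (Fin n)) where
  Adj
    | none, none => False
    | none, some _ => True
    | some _, none => True
    | some i, some j => (SimpleGraph.cycleGraph n).Adj i j
  symm := ⟨by
    rintro (_ | i) (_ | j) h
    · exact h
    · trivial
    · trivial
    · exact SimpleGraph.Adj.symm h⟩
  loopless := ⟨by
    rintro (_ | i) h
    · exact h
    · exact SimpleGraph.irrefl _ h⟩

/-- A walk is a geodesic if it is a path of the shortest possible length. -/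
def IsGeodesic {V : Type*} {G : SimpleGraph V} {x y : V} (p : G.Walk x y) : Prop :=
  p.IsPath ∧ p.length = G.dist x y

/-- A path is rainbow under the edge-colouring `c` if its edges have distinct colours. -/
def IsRainbow {V : Type*} {G : SimpleGraph V} (c : G.edgeSet → ℕ) {x y : V}
    (p : G.Walk x y) : Prop :=
  ∀ e f : G.edgeSet, e.1 ∈ p.edges → f.1 ∈ p.edges → e ≠ f → c e ≠ c f

/-- An edge-colouring is strongly rainbow connected if any two vertices are connected by a
rainbow geodesic. -/
def StronglyRainbowConnected {V : Type*} (G : SimpleGraph V) (c : G.edgeSet → ℕ) : Prop :=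
  ∀ x y : V, ∃ p : G.Walk x y, IsGeodesic p ∧ IsRainbow c p

/-- Every assignment of lists of at least `r` colours to the edges of `G` admits a strongly
rainbow connected edge-colouring that takes the colour of each edge from the list of this edge. -/
def StronglyRainbowChoosable {V : Type*} (G : SimpleGraph V) (r : ℕ) : Prop :=
  ∀ L : G.edgeSet → Set ℕ, (∀ e, (r : ℕ∞) ≤ (L e).encard) →
    ∃ c : G.edgeSet → ℕ, (∀ e, c e ∈ L e) ∧ StronglyRainbowConnected G c

/-- The list strong rainbow connection number of a (finite, connected) graph: the least
positive integer `r` such that `G` is strongly rainbow choosable from lists of size `r`. -/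
noncomputable def listStrongRainbowNumber {V : Type*} (G : SimpleGraph V) : ℕ :=
  sInf {r : ℕ | 1 ≤ r ∧ StronglyRainbowChoosable G r}

/-! Two non-adjacent rim vertices of a wheel have distance two. If they are at distance at least
three on the cycle (`CycleFar`), the hub is their only common neighbour, so their spokes need
different colours. At distance two on the cycle, the path through the rim vertex between them serves
as well. Lists of size three allow consecutive rim edges to get different colours, so it remains to
list-colour the spokes as vertices of the graph of far pairs.

Three consecutive vertices are pairwise not far. Cutting the cycle into k triples and s ≤ 2 single
vertices therefore embeds the far graph in a complete multipartite graph with k parts of size three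
and s of size one. By `exists_listColoring_completeMultipartite`, which rests on Hall's theorem,
lists of size r suffice if k + s ≤ r and 4k + 2s - 1 ≤ 3r. This gives the upper bounds for n = 7 and
n ≥ 10. For n = 8 and n = 9 it would ask for lists of size four, so those far graphs are coloured by
means of kernels, for n = 9 after a case analysis of the colours shared by nearby lists.

Conversely, for n ≥ 7 no colour occurs on four spokes, so constant lists force n ≤ 3r. For n = 4, 5,
6 lists of size two suffice: the rim is coloured greedily, and its one possible clash is repaired by
two spokes. -/

/-! ### List colouring from kernels. -/

/-- A list-colouring lemma of Bondy, Boppana and Siegel: if the edges inside `S` are oriented along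
`out` so that every subset of `S` has a kernel, taken from the independent sets in `I`, then lists larger than the out-degrees suffice. -/
theorem exists_listColoring_of_kernels {V : Type*} [DecidableEq V] (adj : V → V → Prop)
    (out : V → Finset V) (S : Finset V) (I : List (Finset V))
    (hI : ∀ K ∈ I, ∀ v ∈ K, ∀ w ∈ K, ¬ adj v w)
    (hker : ∀ U ∈ S.powerset, ∃ K ∈ I, K ⊆ U ∧ ∀ v ∈ U, v ∈ K ∨ ∃ w ∈ out v, w ∈ K)
    (L : V → Finset ℕ) (hL : ∀ v ∈ S, (out v ∩ S).card < (L v).card) :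
    ∃ f : V → ℕ, (∀ v ∈ S, f v ∈ L v) ∧ ∀ v ∈ S, ∀ w ∈ S, adj v w → f v ≠ f w := by
  induction h : S.card using Nat.strong_induction_on generalizing S L with
  | _ m ih =>
  subst h
  rcases S.eq_empty_or_nonempty with rfl | ⟨v₀, hv₀⟩
  · exact ⟨fun _ => 0, by simp⟩
  obtain ⟨c, hc⟩ : (L v₀).Nonempty := Finset.card_pos.mp (by have := hL v₀ hv₀; omega)
  -- The kernel of the set of vertices that may use `c` is coloured `c`. The other vertices of this
  -- set lose the colour `c` but also an out-neighbour, so the strict inequality survives.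
  have hU : S.filter (fun v => c ∈ L v) ∈ S.powerset := by simp
  obtain ⟨K, hKI, hK, hdom⟩ := hker _ hU
  have hind := hI K hKI
  have hKS : K ⊆ S := hK.trans (Finset.filter_subset _ _)
  have hKne : K.Nonempty := by
    rcases hdom v₀ (by simp [hv₀, hc]) with h | ⟨w, -, hw⟩
    exacts [⟨_, h⟩, ⟨_, hw⟩]
  obtain ⟨f, hf, hf'⟩ := ih (S \ K).card
    (Finset.card_lt_card (Finset.sdiff_ssubset hKS hKne)) (S \ K)
    (fun U hU => hker U (by
      rw [Finset.mem_powerset] at hU ⊢; exact hU.trans Finset.sdiff_subset))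
    (fun v => (L v).erase c) (by
      intro v hv
      rw [Finset.mem_sdiff] at hv
      have h1 := hL v hv.1
      have h2 : out v ∩ (S \ K) ⊆ out v ∩ S :=
        Finset.inter_subset_inter_left Finset.sdiff_subset
      by_cases hcv : c ∈ L v
      · rcases hdom v (by simp [hv.1, hcv]) with h | ⟨w, hw, hwK⟩
        · exact absurd h hv.2
        have : out v ∩ (S \ K) ⊂ out v ∩ S := by
          refine (Finset.ssubset_iff_of_subset h2).mpr ⟨w, ?_, ?_⟩
          · simp [hw, hKS hwK]
          · simp [hwK]
        have := Finset.card_lt_card this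
        rw [Finset.card_erase_of_mem hcv]
        omega
      · rw [Finset.erase_eq_of_notMem hcv]
        exact (Finset.card_le_card h2).trans_lt h1) rfl
  refine ⟨fun v => if v ∈ K then c else f v, ?_, ?_⟩
  · intro v hv
    by_cases hvK : v ∈ K
    · simpa [hvK] using (Finset.mem_filter.mp (hK hvK)).2
    · simpa [hvK] using Finset.mem_of_mem_erase (hf v (by simp [hv, hvK]))
  · intro v hv w hw hvw
    by_cases hvK : v ∈ K <;> by_cases hwK : w ∈ K
    · exact absurd hvw (hind v hvK w hwK)
    · simpa [hvK, hwK] using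
        (Finset.ne_of_mem_erase (hf w (by simp [hw, hwK]))).symm
    · simpa [hvK, hwK] using Finset.ne_of_mem_erase (hf v (by simp [hv, hvK]))
    · simpa [hvK, hwK] using hf' v (by simp [hv, hvK]) w (by simp [hw, hwK]) hvw

/-! ### The far graph on eight and on nine vertices. -/

/-- Two vertices of the cycle `0, 1, …, n - 1` are far apart if their distance is at least three. -/
def CycleFar {n : ℕ} (i j : Fin n) : Prop :=
  (i.val + 3 ≤ j.val ∧ j.val + 3 ≤ i.val + n) ∨ (j.val + 3 ≤ i.val ∧ i.val + 3 ≤ j.val + n)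

instance {n : ℕ} (i j : Fin n) : Decidable (CycleFar i j) := by
  unfold CycleFar; infer_instance

theorem CycleFar.symm {n : ℕ} {i j : Fin n} (h : CycleFar i j) : CycleFar j i := Or.symm h

/-- The subset of `Fin n` that a natural number encodes by its binary digits. -/
def bitSet (n m : ℕ) : Finset (Fin n) := Finset.univ.filter fun i => m.testBit i

theorem mem_bitSet {n m : ℕ} {i : Fin n} : i ∈ bitSet n m ↔ m.testBit i = true := by
  simp [bitSet]

/-- The kernel condition for the digraph on `Fin n` with encoded out-neighbourhoods `out` and the
encoded vertex set `s`, with kernels from the encoded sets in `I`. -/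
def kernelCheck (n : ℕ) (out : List ℕ) (s : ℕ) (I : List ℕ) : Bool :=
  (List.range (2 ^ n)).all fun u => (Nat.land u s != u) || I.any fun k =>
    (Nat.land k u == k) && (List.range n).all fun v =>
      !u.testBit v || k.testBit v || Nat.land (out.getD v 0) k != 0

theorem exists_kernel_of_kernelCheck {n : ℕ} {out : List ℕ} {s : ℕ} {I : List ℕ}
    (h : kernelCheck n out s I = true) (U : Finset (Fin n)) (hU : U ⊆ bitSet n s) :
    ∃ k ∈ I, bitSet n k ⊆ U ∧
      ∀ v ∈ U, v ∈ bitSet n k ∨ ∃ w ∈ bitSet n (out.getD v 0), w ∈ bitSet n k := by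
  set u : ℕ := Nat.ofBits fun i : Fin n => decide (i ∈ U) with hu
  have hbit : ∀ i : Fin n, u.testBit i = decide (i ∈ U) := fun i => by
    rw [hu, Nat.testBit_ofBits_lt _ _ i.2]
  have hbig : ∀ i : ℕ, n ≤ i → u.testBit i = false := fun i hi => by
    rw [hu, Nat.testBit_ofBits_ge _ _ hi]
  have hus : Nat.land u s = u := by
    refine Nat.eq_of_testBit_eq fun i => ?_
    change (u &&& s).testBit i = _
    rw [Nat.testBit_and]
    by_cases hi : i < n
    · have h1 := hbit ⟨i, hi⟩
      by_cases hiU : (⟨i, hi⟩ : Fin n) ∈ U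
      · have := mem_bitSet.mp (hU hiU)
        simp_all
      · simp_all
    · simp [hbig i (not_lt.mp hi)]
  have h1 := List.all_eq_true.mp h u (List.mem_range.mpr (Nat.ofBits_lt_two_pow _))
  rw [hus] at h1
  simp only [bne_self_eq_false, Bool.false_or] at h1
  obtain ⟨k, hkI, hk⟩ := List.any_eq_true.mp h1
  rw [Bool.and_eq_true, beq_iff_eq] at hk
  have hku : ∀ i, k.testBit i = true → u.testBit i = true := fun i hi => by
    rw [← hk.1] at hi
    change (k &&& u).testBit i = true at hi
    rw [Nat.testBit_and, Bool.and_eq_true] at hi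
    exact hi.2
  refine ⟨k, hkI, fun i hi => ?_, fun v hv => ?_⟩
  · simpa [hbit] using hku i (mem_bitSet.mp hi)
  · have h2 := List.all_eq_true.mp hk.2 v (List.mem_range.mpr v.2)
    rw [hbit v] at h2
    simp only [hv, decide_true, Bool.not_true, Bool.false_or, Bool.or_eq_true, bne_iff_ne] at h2
    rcases h2 with h2 | h2
    · exact Or.inl (mem_bitSet.mpr h2)
    · obtain ⟨i, hi⟩ := Nat.exists_testBit_of_ne_zero h2
      change (out.getD v 0 &&& k).testBit i = true at hi
      rw [Nat.testBit_and, Bool.and_eq_true] at hi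
      have hin : i < n := by
        by_contra hin
        have := hku i hi.2
        rw [hbig i (not_lt.mp hin)] at this
        exact absurd this (by decide)
      exact Or.inr ⟨⟨i, hin⟩, mem_bitSet.mpr hi.1, mem_bitSet.mpr hi.2⟩

/-- The encodings of the sets of at most three consecutive vertices of the cycle. -/
def shortArcs (n : ℕ) : List ℕ :=
  0 :: (List.range n).flatMap fun i =>
    [2 ^ i, 2 ^ i + 2 ^ ((i + 1) % n), 2 ^ i + 2 ^ ((i + 2) % n),
      2 ^ i + 2 ^ ((i + 1) % n) + 2 ^ ((i + 2) % n)]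

/-- Kernels are sought only among the short arcs, which are independent in the far graph. The search
over all subsets is then a finite computation on binary codes. -/
theorem cycleFar_listColoring_of_kernelCheck {n : ℕ} (out : List ℕ) (s : ℕ)
    (hI : ∀ k ∈ shortArcs n, ∀ v w : Fin n,
      k.testBit v = true → k.testBit w = true → ¬ CycleFar v w)
    (hker : kernelCheck n out s (shortArcs n) = true) (L : Fin n → Finset ℕ)
    (hL : ∀ v ∈ bitSet n s, (bitSet n (out.getD v 0)).card < (L v).card) :
    ∃ f : Fin n → ℕ, (∀ v ∈ bitSet n s, f v ∈ L v) ∧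
      ∀ v ∈ bitSet n s, ∀ w ∈ bitSet n s, CycleFar v w → f v ≠ f w := by
  refine exists_listColoring_of_kernels CycleFar (fun v : Fin n => bitSet n (out.getD v 0))
    (bitSet n s) ((shortArcs n).map (bitSet n)) ?_ ?_ L
    fun v hv => (Finset.card_le_card Finset.inter_subset_left).trans_lt (hL v hv)
  · intro K hK v hv w hw
    obtain ⟨k, hk, rfl⟩ := List.mem_map.mp hK
    exact hI k hk v w (mem_bitSet.mp hv) (mem_bitSet.mp hw)
  · intro U hU
    obtain ⟨k, hk, h⟩ := exists_kernel_of_kernelCheck hker U (Finset.mem_powerset.mp hU)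
    exact ⟨_, List.mem_map_of_mem hk, h⟩

theorem not_cycleFar_of_mem_shortArcs_eight : ∀ k ∈ shortArcs 8, ∀ v w : Fin 8,
    k.testBit v = true → k.testBit w = true → ¬ CycleFar v w := by
  decide +kernel

theorem not_cycleFar_of_mem_shortArcs_nine : ∀ k ∈ shortArcs 9, ∀ v w : Fin 9,
    k.testBit v = true → k.testBit w = true → ¬ CycleFar v w := by
  decide +kernel

theorem cycleFar_listColoring_eight (L : Fin 8 → Finset ℕ) (hL : ∀ i, 3 ≤ (L i).card) :
    ∃ f : Fin 8 → ℕ, (∀ i, f i ∈ L i) ∧ ∀ i j, CycleFar i j → f i ≠ f j := by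
  obtain ⟨f, hf, hf'⟩ := cycleFar_listColoring_of_kernelCheck
    -- Entry v is the binary code of the out-neighbours of v: 24 = 2³ + 2⁴ stands for the arcs from
    -- 0 to 3 and 4. The far graph is 3-regular with 12 edges, here oriented with out-degrees at
    -- most two.
    [24, 48, 192, 128, 128, 5, 10, 0] 255 not_cycleFar_of_mem_shortArcs_eight
    (by decide +kernel) L
    (fun v _ => lt_of_lt_of_le (by revert v; decide +kernel) (hL v))
  have h : ∀ i, i ∈ bitSet 8 255 := by decide +kernel
  exact ⟨f, fun i => hf i (h i), fun i j => hf' i (h i) j (h j)⟩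

/-- Colour the independent set `x` with `c` and the remaining vertices, encoded by `s`, from the
lists without `c`. -/
theorem cycleFar_listColoring_nine_of_kernelCheck (L : Fin 9 → Finset ℕ)
    (hL : ∀ i, 3 ≤ (L i).card) (c : ℕ) (x g : List (Fin 9)) (s : ℕ) (out : List ℕ)
    (hc : ∀ v ∈ x, c ∈ L v) (hg : ∀ v ∈ g, c ∉ L v)
    (hx : (∀ v ∈ x, ∀ w ∈ x, ¬ CycleFar v w) ∧ (∀ v, v ∉ x → v ∈ bitSet 9 s) ∧
      (∀ v ∈ bitSet 9 s, (bitSet 9 (out.getD v 0)).card ≤ 1 ∨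
        v ∈ g ∧ (bitSet 9 (out.getD v 0)).card ≤ 2) ∧
      kernelCheck 9 out s (shortArcs 9) = true) :
    ∃ f : Fin 9 → ℕ, (∀ i, f i ∈ L i) ∧ ∀ i j, CycleFar i j → f i ≠ f j := by
  obtain ⟨hx, hs, hdeg, hker⟩ := hx
  obtain ⟨f, hf, hf'⟩ := cycleFar_listColoring_of_kernelCheck out s
    not_cycleFar_of_mem_shortArcs_nine hker (fun v => (L v).erase c) (by
      intro v hv
      have h3 := hL v
      -- A list without `c` keeps three colours and tolerates out-degree two; any other keeps at
      -- least two and tolerates out-degree one.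
      rcases hdeg v hv with h | ⟨h, h'⟩
      · have := Finset.pred_card_le_card_erase (s := L v) (a := c)
        omega
      · rw [Finset.erase_eq_of_notMem (hg v h)]
        omega)
  refine ⟨fun v => if v ∈ x then c else f v, fun v => ?_, fun v w hvw => ?_⟩
  · by_cases hv : v ∈ x
    · simpa [hv] using hc v hv
    · simpa [hv] using Finset.mem_of_mem_erase (hf v (hs v hv))
  · by_cases hv : v ∈ x <;> by_cases hw : w ∈ x
    · exact absurd hvw (hx v hv w hw)
    · simpa [hv, hw] using (Finset.ne_of_mem_erase (hf w (hs w hw))).symm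
    · simpa [hv, hw] using Finset.ne_of_mem_erase (hf v (hs v hv))
    · simpa [hv, hw] using hf' v (hs v hv) w (hs w hw) hvw

theorem cycleFar_listColoring_nine_of_mem_three (L : Fin 9 → Finset ℕ)
    (hL : ∀ i, 3 ≤ (L i).card) (c : ℕ) (h0 : c ∈ L 0) (h1 : c ∈ L 1) (h2 : c ∈ L 2) :
    ∃ f : Fin 9 → ℕ, (∀ i, f i ∈ L i) ∧ ∀ i j, CycleFar i j → f i ≠ f j := by
  exact cycleFar_listColoring_nine_of_kernelCheck L hL c [0, 1, 2] [] 504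
      [0, 0, 0, 128, 256, 256, 8, 16, 8] (by simp [h0, h1, h2]) (by simp) (by decide +kernel)

/-- With 0 and 1 coloured `c`, the seven other vertices span 18 - 8 = 10 far pairs, so an
orientation within the allowed out-degrees needs at least three lists without `c`. Those of 2 and 8
are such; the cases supply a third, or a third and a fourth. -/
theorem cycleFar_listColoring_nine_of_mem_consecutive (L : Fin 9 → Finset ℕ)
    (hL : ∀ i, 3 ≤ (L i).card)
    (hthree : ∀ i c, c ∈ L i → c ∈ L (i + 1) → c ∉ L (i + 2))
    (c : ℕ) (h0 : c ∈ L 0) (h1 : c ∈ L 1) :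
    ∃ f : Fin 9 → ℕ, (∀ i, f i ∈ L i) ∧ ∀ i j, CycleFar i j → f i ≠ f j := by
  have h2 : c ∉ L 2 := hthree 0 c h0 h1
  have h8 : c ∉ L 8 := fun h => hthree 8 c h h0 h1
  by_cases h5 : c ∈ L 5
  swap
  · exact cycleFar_listColoring_nine_of_kernelCheck L hL c [0, 1] [2, 8, 5] 508
      [0, 0, 192, 128, 256, 260, 8, 16, 12] (by simp [h0, h1]) (by simp [h2, h8, h5]) (by decide +kernel)
  have h34 : c ∉ L 3 ∨ c ∉ L 4 := by
    by_contra! h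
    exact hthree 3 c h.1 h.2 h5
  have h67 : c ∉ L 6 ∨ c ∉ L 7 := by
    by_contra! h
    exact hthree 5 c h5 h.1 h.2
  rcases h34 with h3 | h4
  · rcases h67 with h6 | h7
    · exact cycleFar_listColoring_nine_of_kernelCheck L hL c [0, 1] [2, 8, 3, 6] 508
        [0, 0, 160, 384, 256, 0, 12, 16, 36] (by simp [h0, h1]) (by simp [h2, h8, h3, h6]) (by decide +kernel)
    · exact cycleFar_listColoring_nine_of_kernelCheck L hL c [0, 1] [2, 8, 3, 7] 508
        [0, 0, 96, 384, 256, 0, 8, 20, 36] (by simp [h0, h1]) (by simp [h2, h8, h3, h7]) (by decide +kernel)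
  · rcases h67 with h6 | h7
    · exact cycleFar_listColoring_nine_of_kernelCheck L hL c [0, 1] [2, 8, 4, 6] 508
        [0, 0, 160, 256, 384, 0, 12, 8, 36] (by simp [h0, h1]) (by simp [h2, h8, h4, h6]) (by decide +kernel)
    · exact cycleFar_listColoring_nine_of_kernelCheck L hL c [0, 1] [2, 8, 4, 7] 508
        [0, 0, 96, 256, 384, 0, 8, 12, 36] (by simp [h0, h1]) (by simp [h2, h8, h4, h7]) (by decide +kernel)

/-- Neighbouring lists are now disjoint, so 1, 3 and 8 lack `c`. Deciding whether `c` lies in the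
lists of 5 and 6 yields two further vertices without it. -/
theorem cycleFar_listColoring_nine_of_mem_alternate (L : Fin 9 → Finset ℕ)
    (hL : ∀ i, 3 ≤ (L i).card) (htwo : ∀ i c, c ∈ L i → c ∉ L (i + 1))
    (c : ℕ) (h0 : c ∈ L 0) (h2 : c ∈ L 2) :
    ∃ f : Fin 9 → ℕ, (∀ i, f i ∈ L i) ∧ ∀ i j, CycleFar i j → f i ≠ f j := by
  have h1 : c ∉ L 1 := htwo 0 c h0
  have h3 : c ∉ L 3 := htwo 2 c h2
  have h8 : c ∉ L 8 := fun h => htwo 8 c h h0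
  by_cases h5 : c ∈ L 5
  · have h4 : c ∉ L 4 := fun h => htwo 4 c h h5
    have h6 : c ∉ L 6 := htwo 5 c h5
    exact cycleFar_listColoring_nine_of_kernelCheck L hL c [0, 2] [1, 3, 8, 4, 6] 506
      [0, 144, 0, 384, 384, 2, 10, 0, 32] (by simp [h0, h2]) (by simp [h1, h3, h8, h4, h6]) (by decide +kernel)
  · by_cases h6 : c ∈ L 6
    · have h7 : c ∉ L 7 := htwo 6 c h6
      exact cycleFar_listColoring_nine_of_kernelCheck L hL c [0, 2] [1, 3, 8, 5, 7] 506
        [0, 80, 0, 192, 256, 258, 0, 18, 8] (by simp [h0, h2]) (by simp [h1, h3, h8, h5, h7]) (by decide +kernel)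
    · exact cycleFar_listColoring_nine_of_kernelCheck L hL c [0, 2] [1, 3, 8, 5, 6] 506
        [0, 144, 0, 192, 128, 258, 2, 0, 24] (by simp [h0, h2]) (by simp [h1, h3, h8, h5, h6]) (by decide +kernel)

/-- Hall's condition: three consecutive vertices see nine colours, and two at distance at most two
see six. More than six vertices of the 9-cycle contain the former, more than three the latter. -/
theorem injective_listColoring_nine_of_disjoint (L : Fin 9 → Finset ℕ)
    (hL : ∀ i, 3 ≤ (L i).card) (hone : ∀ i, Disjoint (L i) (L (i + 1)))
    (htwo : ∀ i, Disjoint (L i) (L (i + 2))) :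
    ∃ f : Fin 9 → ℕ, Function.Injective f ∧ ∀ i, f i ∈ L i := by
  refine (Finset.all_card_le_biUnion_card_iff_exists_injective L).mp fun S => ?_
  have hsub : ∀ i ∈ S, L i ⊆ S.biUnion L := fun i hi => Finset.subset_biUnion_of_mem L hi
  have hpair : ∀ i ∈ S, ∀ j ∈ S, Disjoint (L i) (L j) → 6 ≤ (S.biUnion L).card :=
    fun i hi j hj hd => by
      have h := Finset.card_le_card (Finset.union_subset (hsub i hi) (hsub j hj))
      rw [Finset.card_union_of_disjoint hd] at h
      linarith [hL i, hL j]
  by_cases h3 : ∃ i, i ∈ S ∧ i + 1 ∈ S ∧ i + 2 ∈ S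
  · obtain ⟨i, h0, h1, h2⟩ := h3
    have h12 : Disjoint (L (i + 1)) (L (i + 2)) := by
      have := hone (i + 1)
      rwa [add_assoc] at this
    have h := Finset.card_le_card (Finset.union_subset (Finset.union_subset (hsub _ h0)
      (hsub _ h1)) (hsub _ h2))
    rw [Finset.card_union_of_disjoint (Finset.disjoint_union_left.mpr ⟨htwo i, h12⟩),
      Finset.card_union_of_disjoint (hone i)] at h
    have hS : S.card ≤ 9 := by simpa using Finset.card_le_univ S
    linarith [hL i, hL (i + 1), hL (i + 2)]
  by_cases h2 : ∃ i, i ∈ S ∧ (i + 1 ∈ S ∨ i + 2 ∈ S)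
  · have h6 : 6 ≤ (S.biUnion L).card := by
      obtain ⟨i, hi, h | h⟩ := h2
      exacts [hpair _ hi _ h (hone i), hpair _ hi _ h (htwo i)]
    refine le_trans ?_ h6
    by_contra hcard
    exact h3 ((by decide +kernel : ∀ S : Finset (Fin 9), 6 < S.card →
      ∃ i, i ∈ S ∧ i + 1 ∈ S ∧ i + 2 ∈ S) S (not_le.mp hcard))
  · rcases S.eq_empty_or_nonempty with rfl | ⟨i, hi⟩
    · simp
    refine le_trans ?_ ((hL i).trans (Finset.card_le_card (hsub i hi)))
    by_contra hcard
    exact h2 ((by decide +kernel : ∀ S : Finset (Fin 9), 3 < S.card →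
      ∃ i, i ∈ S ∧ (i + 1 ∈ S ∨ i + 2 ∈ S)) S (not_le.mp hcard))

theorem cycleFar_sub_nine : ∀ t i j : Fin 9, CycleFar i j → CycleFar (i - t) (j - t) := by
  decide +kernel

theorem cycleFar_listColoring_nine_of_rotate (L : Fin 9 → Finset ℕ) (t : Fin 9)
    (h : ∃ f : Fin 9 → ℕ, (∀ i, f i ∈ L (i + t)) ∧ ∀ i j, CycleFar i j → f i ≠ f j) :
    ∃ f : Fin 9 → ℕ, (∀ i, f i ∈ L i) ∧ ∀ i j, CycleFar i j → f i ≠ f j := by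
  obtain ⟨f, hf, hf'⟩ := h
  refine ⟨fun i => f (i - t), fun i => by simpa using hf (i - t), fun i j hij => ?_⟩
  exact hf' _ _ (cycleFar_sub_nine t i j hij)

theorem cycleFar_listColoring_nine (L : Fin 9 → Finset ℕ) (hL : ∀ i, 3 ≤ (L i).card) :
    ∃ f : Fin 9 → ℕ, (∀ i, f i ∈ L i) ∧ ∀ i j, CycleFar i j → f i ≠ f j := by
  by_cases h3 : ∀ i c, c ∈ L i → c ∈ L (i + 1) → c ∉ L (i + 2)
  swap
  · push Not at h3
    obtain ⟨i, c, h0, h1, h2⟩ := h3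
    refine cycleFar_listColoring_nine_of_rotate L i
      (cycleFar_listColoring_nine_of_mem_three _ (fun j => hL _) c ?_ ?_ ?_)
    · simpa using h0
    · simpa [add_comm] using h1
    · simpa [add_comm] using h2
  by_cases h2 : ∀ i c, c ∈ L i → c ∉ L (i + 1)
  swap
  · push Not at h2
    obtain ⟨i, c, h0, h1⟩ := h2
    refine cycleFar_listColoring_nine_of_rotate L i
      (cycleFar_listColoring_nine_of_mem_consecutive _ (fun j => hL _) (fun j c => ?_) c ?_ ?_)
    · have := h3 (j + i) c
      rwa [add_right_comm j i 1, add_right_comm j i 2] at this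
    · simpa using h0
    · simpa [add_comm] using h1
  by_cases h1 : ∀ i c, c ∈ L i → c ∉ L (i + 2)
  swap
  · push Not at h1
    obtain ⟨i, c, h0, h1⟩ := h1
    refine cycleFar_listColoring_nine_of_rotate L i
      (cycleFar_listColoring_nine_of_mem_alternate _ (fun j => hL _) (fun j c => ?_) c ?_ ?_)
    · have := h2 (j + i) c
      rwa [add_right_comm j i 1] at this
    · simpa using h0
    · simpa [add_comm] using h1
  obtain ⟨f, hf, hf'⟩ := injective_listColoring_nine_of_disjoint L hL
    (fun i => Finset.disjoint_left.mpr fun c => h2 i c)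
    (fun i => Finset.disjoint_left.mpr fun c => h1 i c)
  refine ⟨f, hf', fun i j hij h => ?_⟩
  rw [hf h] at hij
  unfold CycleFar at hij
  omega

/-! ### Complete multipartite graphs with parts of size three and one. -/

/-- The colours common to the two lists other than the `i`-th one. -/
def commonColors {γ : Type*} [DecidableEq γ] (A : Fin 3 → Finset γ) (i : Fin 3) : Finset γ :=
  A (i + 1) ∩ A (i + 2)

section
variable {γ : Type*} [DecidableEq γ]

theorem disjoint_commonColors {A : Fin 3 → Finset γ} (h : A 0 ∩ A 1 ∩ A 2 = ∅) (i : Fin 3) :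
    Disjoint (A i) (commonColors A i) := by
  have h' : ∀ c, c ∈ A 0 → c ∈ A 1 → c ∉ A 2 := fun c h0 h1 h2 => by
    simpa [h] using (by simp [h0, h1, h2] : c ∈ A 0 ∩ A 1 ∩ A 2)
  rw [Finset.disjoint_left]
  intro c hc hc'
  rw [commonColors, Finset.mem_inter] at hc'
  fin_cases i
  · exact h' c hc hc'.1 hc'.2
  · exact h' c hc'.2 hc hc'.1
  · exact h' c hc'.1 hc'.2 hc

/-- No colour is counted three times on the left, and those counted twice are the common colours. -/
theorem sum_card_le_card_add_card_commonColors {A : Fin 3 → Finset γ}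
    (h : A 0 ∩ A 1 ∩ A 2 = ∅) :
    (A 0).card + (A 1).card + (A 2).card ≤
      (A 0 ∪ A 1 ∪ A 2).card + (Finset.univ.biUnion (commonColors A)).card := by
  have h1 := Finset.card_union_add_card_inter (A 0) (A 1)
  have h2 := Finset.card_union_add_card_inter (A 0 ∪ A 1) (A 2)
  have h3 : (A 0 ∩ A 1).card + ((A 0 ∪ A 1) ∩ A 2).card ≤
      (Finset.univ.biUnion (commonColors A)).card := by
    rw [← Finset.card_union_of_disjoint]
    · refine Finset.card_le_card fun c hc => ?_
      simp only [Finset.mem_union, Finset.mem_inter] at hc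
      simp only [Finset.mem_biUnion, Finset.mem_univ, true_and, commonColors, Finset.mem_inter]
      rcases hc with h | ⟨h | h, h'⟩
      · exact ⟨2, h.1, h.2⟩
      · exact ⟨1, h', h⟩
      · exact ⟨0, h, h'⟩
    · rw [Finset.disjoint_left]
      intro c hc hc'
      have : c ∈ A 0 ∩ A 1 ∩ A 2 := Finset.mem_inter.mpr ⟨hc, (Finset.mem_inter.mp hc').2⟩
      simp [h] at this
  omega

theorem exists_injOn_of_card_le {α : Type*} [DecidableEq α] (T : Finset α) (M : α → Finset γ)
    (h : ∀ a ∈ T, T.card ≤ (M a).card) :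
    ∃ f : T → γ, Function.Injective f ∧ ∀ a : T, f a ∈ M a := by
  refine (Finset.all_card_le_biUnion_card_iff_exists_injective (fun a : T => M a)).mp fun S => ?_
  rcases S.eq_empty_or_nonempty with rfl | ⟨a, ha⟩
  · simp
  calc S.card ≤ T.card := by simpa using Finset.card_le_univ S
    _ ≤ (M a).card := h a a.2
    _ ≤ _ := Finset.card_le_card (Finset.subset_biUnion_of_mem (fun a : T => M a) ha)

/-- A maximal partial system of distinct representatives. -/
theorem exists_maximal_partial_transversal {α : Type*} [DecidableEq α] [Inhabited γ]
    (P : Finset α) (H : α → Finset γ) :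
    ∃ T ⊆ P, ∃ f : α → γ, Set.InjOn f T ∧ (∀ a ∈ T, f a ∈ H a) ∧
      ∀ a ∈ P, a ∉ T → H a ⊆ T.image f := by
  classical
  set F : Finset (Finset α) := P.powerset.filter fun T =>
    ∃ f : α → γ, Set.InjOn f T ∧ ∀ a ∈ T, f a ∈ H a with hF
  have hne : F.Nonempty := ⟨∅, by simp [hF]⟩
  obtain ⟨T, hT, hmax⟩ := F.exists_max_image Finset.card hne
  obtain ⟨hTP, f, hinj, hf⟩ := (by simpa [hF] using hT :
    T ⊆ P ∧ ∃ f : α → γ, Set.InjOn f T ∧ ∀ a ∈ T, f a ∈ H a)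
  refine ⟨T, hTP, f, hinj, hf, fun a haP haT c hc => ?_⟩
  by_contra hcT
  have hup : ∀ b ∈ T, Function.update f a c b = f b := fun b hb =>
    Function.update_of_ne (ne_of_mem_of_not_mem hb haT) _ _
  have : insert a T ∈ F := by
    rw [hF, Finset.mem_filter, Finset.mem_powerset]
    refine ⟨Finset.insert_subset haP hTP, Function.update f a c, ?_, ?_⟩
    · rw [Finset.coe_insert, Set.injOn_insert (by simpa using haT)]
      refine ⟨hinj.congr fun b hb => (hup b hb).symm, ?_⟩
      rintro ⟨b, hb, hbc⟩
      rw [hup b hb, Function.update_self] at hbc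
      exact hcT (hbc ▸ Finset.mem_image_of_mem f hb)
    · intro b hb
      rcases Finset.mem_insert.mp hb with rfl | hb
      · simpa using hc
      · rw [hup b hb]; exact hf b hb
  have := hmax _ this
  rw [Finset.card_insert_of_notMem haT] at this
  omega

/-- A set between two superlevel sets whose size is the difference of the levels. -/
theorem exists_subset_card_threshold {α : Type*} [DecidableEq α] (Q : Finset α) (w : α → ℕ)
    (m : ℕ) :
    ∃ T ⊆ Q, (∀ a ∈ T, m + T.card ≤ w a) ∧ ∀ a ∈ Q, a ∉ T → w a ≤ m + T.card := by
  -- As with an h-index, j is a level at which at least j elements reach m + j but at most j reach m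
  -- + j + 1. A set of size j fits between the two.
  obtain ⟨j, hj, hj'⟩ : ∃ j, j ≤ (Q.filter fun a => m + j ≤ w a).card ∧
      ¬ j + 1 ≤ (Q.filter fun a => m + (j + 1) ≤ w a).card := by
    by_contra! hcon
    have hall : ∀ j, j ≤ (Q.filter fun a => m + j ≤ w a).card := fun j => by
      induction j with
      | zero => exact Nat.zero_le _
      | succ j ih => exact hcon j ih
    have := (hall (Q.card + 1)).trans (Finset.card_filter_le _ _)
    omega
  obtain ⟨T, hT1, hT2, hT3⟩ := Finset.exists_subsuperset_card_eq
    (s := Q.filter fun a => m + (j + 1) ≤ w a) (t := Q.filter fun a => m + j ≤ w a) (n := j)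
    (fun a ha => by
      rw [Finset.mem_filter] at ha ⊢
      exact ⟨ha.1, by omega⟩) (by omega) hj
  refine ⟨T, fun a ha => (Finset.mem_filter.mp (hT2 ha)).1, fun a ha => ?_, fun a ha haT => ?_⟩
  · rw [hT3]; exact (Finset.mem_filter.mp (hT2 ha)).2
  · by_contra hcon
    exact haT (hT1 (Finset.mem_filter.mpr ⟨ha, by omega⟩))

end

/-- Which pairs of vertices of the parts of size three are to be coloured alike: `T₁` and `T₂` are
the parts with such a pair, `e` its complement and `f` distinct colours showing that these pairs
can be coloured. -/
theorem exists_merged_pairs {α γ : Type*} [DecidableEq α] [DecidableEq γ] [Inhabited γ]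
    (P : Finset α) (A : α → Fin 3 → Finset γ) (r s : ℕ)
    (hrs : P.card + s ≤ r) (hr : 4 * P.card + 2 * s ≤ 3 * r + 1) :
    ∃ T₁ T₂ : Finset α, T₁ ⊆ P ∧ T₂ ⊆ P ∧ Disjoint T₁ T₂ ∧
      ∃ (f : α → γ) (e : α → Fin 3), Set.InjOn f ((T₁ ∪ T₂ : Finset α) : Set α) ∧
        (∀ a ∈ T₁ ∪ T₂, f a ∈ commonColors (A a) (e a)) ∧
        (∀ a ∈ T₁, 2 * P.card + s ≤ r + (commonColors (A a) (e a)).card) ∧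
        (∀ a ∈ T₂, P.card + s + T₂.card ≤ r + (commonColors (A a) (e a)).card) ∧
        ∀ a ∈ P, a ∉ T₁ ∪ T₂ →
          (∀ i, (commonColors (A a) i).card + 2 * P.card + s ≤ 2 * r + T₁.card) ∧
          (Finset.univ.biUnion (commonColors (A a))).card + 3 * P.card + s ≤
            3 * r + T₁.card + T₂.card := by
  set D : α → Fin 3 → Finset γ := fun a => commonColors (A a) with hD
  set k := P.card with hk
  -- Call a pair heavy if it shares at least 2k + s - r colours. By maximality of `T₁`, in a part
  -- outside `T₁` each heavy pair has all its common colours already used by `f₁`.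
  obtain ⟨T₁, hT₁, f₁, hinj₁, hf₁, hmax⟩ := exists_maximal_partial_transversal P
    fun a => (Finset.univ.filter fun i => 2 * k + s ≤ r + (D a i).card).biUnion (D a)
  have hheavy : ∀ a ∈ P, a ∉ T₁ → ∀ i, D a i ⊆ T₁.image f₁ ∨ r + (D a i).card + 1 ≤ 2 * k + s := by
    intro a ha haT i
    by_cases h : 2 * k + s ≤ r + (D a i).card
    · refine Or.inl fun c hc => hmax a ha haT ?_
      simp only [Finset.mem_biUnion, Finset.mem_filter, Finset.mem_univ, true_and]
      exact ⟨i, h, hc⟩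
    · exact Or.inr (by omega)
  have hcardT₁ : (T₁.image f₁).card ≤ T₁.card := Finset.card_image_le
  obtain ⟨T₂, hT₂, hlarge, hsmall⟩ := exists_subset_card_threshold (P \ T₁)
    (fun a => (Finset.univ.biUnion (D a)).card + 3 * k + s) (3 * r + T₁.card)
  have hT₂P : ∀ a ∈ T₂, a ∈ P ∧ a ∉ T₁ := fun a ha => Finset.mem_sdiff.mp (hT₂ ha)
  obtain ⟨f₂, hinj₂, hf₂⟩ := exists_injOn_of_card_le T₂
    (fun a => Finset.univ.biUnion (D a) \ T₁.image f₁) (fun a ha => by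
      have h1 := hlarge a ha
      have h2 := Finset.le_card_sdiff (T₁.image f₁) (Finset.univ.biUnion (D a))
      omega)
  have hdisj : Disjoint T₁ T₂ := Finset.disjoint_right.mpr fun a ha => (hT₂P a ha).2
  set f : α → γ := fun a => if a ∈ T₁ then f₁ a else if h : a ∈ T₂ then f₂ ⟨a, h⟩ else default
    with hf
  have hfT₁ : ∀ a ∈ T₁, f a = f₁ a := fun a ha => by simp [hf, ha]
  have hfT₂ : ∀ a (ha : a ∈ T₂), f a = f₂ ⟨a, ha⟩ := fun a ha => by
    simp [hf, ha, (hT₂P a ha).2]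
  have he : ∀ a, ∃ i, (a ∈ T₁ → 2 * k + s ≤ r + (D a i).card ∧ f a ∈ D a i) ∧
      (a ∈ T₂ → f a ∈ D a i) := by
    intro a
    by_cases h1 : a ∈ T₁
    · have h := hf₁ a h1
      simp only [Finset.mem_biUnion, Finset.mem_filter, Finset.mem_univ, true_and] at h
      obtain ⟨i, hi, hi'⟩ := h
      exact ⟨i, fun _ => ⟨hi, hfT₁ a h1 ▸ hi'⟩, fun h => absurd h1 (hT₂P a h).2⟩
    · by_cases h2 : a ∈ T₂
      · have h := (Finset.mem_sdiff.mp (hf₂ ⟨a, h2⟩)).1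
        simp only [Finset.mem_biUnion, Finset.mem_univ, true_and] at h
        obtain ⟨i, hi⟩ := h
        exact ⟨i, fun h => absurd h h1, fun _ => by rwa [hfT₂ a h2]⟩
      · exact ⟨0, fun h => absurd h h1, fun h => absurd h h2⟩
  choose e he₁ he₂ using he
  refine ⟨T₁, T₂, hT₁, fun a ha => (hT₂P a ha).1, hdisj, f, e, ?_, ?_, fun a ha => (he₁ a ha).1,
    ?_, ?_⟩
  · have hne : ∀ a ∈ T₁, ∀ b ∈ T₂, f a ≠ f b := fun a ha b hb h => by
      rw [hfT₁ a ha, hfT₂ b hb] at h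
      exact (Finset.mem_sdiff.mp (hf₂ ⟨b, hb⟩)).2 (h ▸ Finset.mem_image_of_mem f₁ ha)
    intro a ha b hb hab
    rw [Finset.mem_coe, Finset.mem_union] at ha hb
    rcases ha with ha | ha <;> rcases hb with hb | hb
    · rw [hfT₁ a ha, hfT₁ b hb] at hab
      exact hinj₁ ha hb hab
    · exact absurd hab (hne a ha b hb)
    · exact absurd hab.symm (hne b hb a ha)
    · rw [hfT₂ a ha, hfT₂ b hb] at hab
      exact congrArg Subtype.val (hinj₂ hab)
  · intro a ha
    rcases Finset.mem_union.mp ha with ha | ha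
    exacts [(he₁ a ha).2, he₂ a ha]
  · intro a ha
    have hl := hlarge a ha
    obtain ⟨haP, haT₁⟩ := hT₂P a ha
    have hnot : ¬ D a (e a) ⊆ T₁.image f₁ := fun h =>
      (Finset.mem_sdiff.mp (hf₂ ⟨a, ha⟩)).2 (hfT₂ a ha ▸ h (he₂ a ha))
    have h0 := (hheavy a haP haT₁ (e a)).resolve_left hnot
    have hcover : Finset.univ.biUnion (D a) ⊆ D a (e a) ∪ D a (e a + 1) ∪ D a (e a + 2) := by
      intro c hc
      simp only [Finset.mem_biUnion, Finset.mem_univ, true_and, Finset.mem_union] at hc ⊢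
      obtain ⟨i, hi⟩ := hc
      generalize e a = j
      fin_cases i <;> fin_cases j <;> simp_all
    have hc1 := Finset.card_le_card hcover
    have hU : ∀ X Y : Finset γ, (X ∪ Y).card ≤ X.card + Y.card := Finset.card_union_le
    have := hU (D a (e a) ∪ D a (e a + 1)) (D a (e a + 2))
    have := hU (D a (e a)) (D a (e a + 1))
    change P.card + s + T₂.card ≤ r + (D a (e a)).card
    -- Each of the two other pairs contributes only colours of `f₁` or fewer than 2k + s - r
    -- colours, so much of the union must come from the merged pair. When both are light, twice the
    -- bound `hr` is exactly what is needed.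
    rcases hheavy a haP haT₁ (e a + 1) with h1 | h1 <;>
      rcases hheavy a haP haT₁ (e a + 2) with h2 | h2
    · have h3 := Finset.card_le_card (hcover.trans (Finset.union_subset_union
        (Finset.union_subset_union subset_rfl h1) h2))
      rw [Finset.union_assoc, Finset.union_self] at h3
      have := hU (D a (e a)) (T₁.image f₁)
      omega
    · have := Finset.card_le_card h1
      omega
    · have := Finset.card_le_card h2
      omega
    · omega
  · intro a ha haT
    rw [Finset.mem_union, not_or] at haT
    refine ⟨fun i => ?_, ?_⟩
    · change (D a i).card + 2 * k + s ≤ _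
      rcases hheavy a ha haT.1 i with h | h
      · have := Finset.card_le_card h
        omega
      · omega
    · exact hsmall a (Finset.mem_sdiff.mpr ⟨ha, haT.1⟩) haT.2

section
variable {α γ : Type*} [DecidableEq α] [DecidableEq γ]

theorem sum_add_card_le_mul {P T : Finset α} (hT : T ⊆ P) (N : α → ℕ) (m : ℕ)
    (h : ∀ a ∈ P, N a + (if a ∈ T then 1 else 0) ≤ m) : ∑ a ∈ P, N a + T.card ≤ m * P.card := by
  have h1 := Finset.sum_le_sum h
  rw [Finset.sum_add_distrib, Finset.sum_const, smul_eq_mul, Finset.sum_boole,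
    Finset.filter_mem_eq_inter, Finset.inter_eq_right.mpr hT, mul_comm] at h1
  exact_mod_cast h1

theorem sum_le_mul_add_card {P T : Finset α} (hT : T ⊆ P) (N : α → ℕ) (m : ℕ)
    (h : ∀ a ∈ P, N a ≤ m + (if a ∈ T then 1 else 0)) : ∑ a ∈ P, N a ≤ m * P.card + T.card := by
  have h1 := Finset.sum_le_sum h
  rw [Finset.sum_add_distrib, Finset.sum_const, smul_eq_mul, Finset.sum_boole,
    Finset.filter_mem_eq_inter, Finset.inter_eq_right.mpr hT, mul_comm] at h1
  exact_mod_cast h1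

theorem inter_eq_commonColors (A : Fin 3 → Finset γ) {i j : Fin 3} (h : i ≠ j) :
    ∃ l, A i ∩ A j = commonColors A l := by
  fin_cases i <;> fin_cases j <;> first | exact absurd rfl h | skip
  exacts [⟨2, rfl⟩, ⟨1, Finset.inter_comm _ _⟩, ⟨2, Finset.inter_comm _ _⟩, ⟨0, rfl⟩, ⟨1, rfl⟩,
    ⟨0, Finset.inter_comm _ _⟩]

/-- In each part of T₁ ∪ T₂ the vertices `e a + 1` and `e a + 2` are merged into one whose list is
their common colours; Hall's theorem then gives all remaining vertices distinct colours. To check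
Hall's condition for S, take the first case that occurs: S contains a whole unmerged part, both
vertices of a part in T₁, two vertices of an unmerged part, or both vertices of a part in T₂. Each
conclusion of `exists_merged_pairs` settles one of these. Otherwise S meets every part at most once:
then |S| ≤ k + s ≤ r settles it if some list has r colours, and otherwise S consists of merged
vertices, for which `f` is a system of representatives. -/
theorem exists_listColoring_of_inter_eq_empty {β : Type*} [Fintype β] [DecidableEq β]
    [Inhabited γ] (P : Finset α) (r : ℕ) (A : α → Fin 3 → Finset γ) (B : β → Finset γ)
    (hA : ∀ a ∈ P, ∀ i, r ≤ (A a i).card) (hB : ∀ b, r ≤ (B b).card)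
    (hrs : P.card + Fintype.card β ≤ r) (hr : 4 * P.card + 2 * Fintype.card β ≤ 3 * r + 1)
    (hdisj : ∀ a ∈ P, A a 0 ∩ A a 1 ∩ A a 2 = ∅) :
    ∃ (f : α → Fin 3 → γ) (g : β → γ), (∀ a ∈ P, ∀ i, f a i ∈ A a i) ∧ (∀ b, g b ∈ B b) ∧
      (∀ a ∈ P, ∀ a' ∈ P, a ≠ a' → ∀ i j, f a i ≠ f a' j) ∧ Function.Injective g ∧
      ∀ a ∈ P, ∀ i b, f a i ≠ g b := by
  classical
  obtain ⟨T₁, T₂, hT₁, hT₂, hT₁₂, f, e, hinj, hfe, h₁, h₂, h₃⟩ :=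
    exists_merged_pairs P A r _ hrs hr
  set s := Fintype.card β with hs
  set k := P.card with hk
  have hTP : T₁ ∪ T₂ ⊆ P := Finset.union_subset hT₁ hT₂
  have hcT : (T₁ ∪ T₂).card = T₁.card + T₂.card := Finset.card_union_of_disjoint hT₁₂
  set valid : α × Fin 3 ⊕ β → Prop := fun x => ∀ p, x = Sum.inl p →
    p.1 ∈ P ∧ (p.1 ∈ T₁ ∪ T₂ → p.2 ≠ e p.1 + 2) with hvalid
  set M : α × Fin 3 ⊕ β → Finset γ := Sum.elim
    (fun p => if p.1 ∈ T₁ ∪ T₂ ∧ p.2 ≠ e p.1 then commonColors (A p.1) (e p.1) else A p.1 p.2) B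
    with hM
  have hall : ∀ S : Finset (α × Fin 3 ⊕ β), (∀ x ∈ S, valid x) → S.card ≤ (S.biUnion M).card := by
    intro S hS
    have hsub : ∀ x ∈ S, M x ⊆ S.biUnion M := fun x hx => Finset.subset_biUnion_of_mem M hx
    set X : α → Finset (Fin 3) := fun a => Finset.univ.filter fun i => Sum.inl (a, i) ∈ S with hX
    have hXmem : ∀ a i, i ∈ X a ↔ Sum.inl (a, i) ∈ S := fun a i => by simp [hX]
    have hScard : S.card ≤ ∑ a ∈ P, (X a).card + s := by
      have hcov : S ⊆ P.biUnion (fun a => (X a).image fun i => Sum.inl (a, i)) ∪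
          Finset.univ.image Sum.inr := by
        rintro (⟨a, i⟩ | b) hx
        · refine Finset.mem_union_left _ (Finset.mem_biUnion.mpr ⟨a, (hS _ hx _ rfl).1, ?_⟩)
          exact Finset.mem_image_of_mem _ ((hXmem a i).mpr hx)
        · exact Finset.mem_union_right _ (Finset.mem_image_of_mem _ (Finset.mem_univ b))
      refine (Finset.card_le_card hcov).trans ((Finset.card_union_le _ _).trans ?_)
      refine Nat.add_le_add (Finset.card_biUnion_le.trans
        (Finset.sum_le_sum fun a _ => Finset.card_image_le)) Finset.card_image_le
    have hX3 : ∀ a, (X a).card ≤ 3 := fun a => by simpa using Finset.card_le_univ (X a)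
    have hXT : ∀ a ∈ T₁ ∪ T₂, X a ⊆ {e a, e a + 1} := by
      intro a ha i hi
      have := (hS _ ((hXmem a i).mp hi) _ rfl).2 ha
      have key : ∀ i j : Fin 3, i ≠ j + 2 → i ∈ ({j, j + 1} : Finset (Fin 3)) := by decide
      exact key _ _ this
    have hXT2 : ∀ a ∈ T₁ ∪ T₂, (X a).card ≤ 2 := fun a ha =>
      (Finset.card_le_card (hXT a ha)).trans Finset.card_le_two
    have hdouble : ∀ a ∈ T₁ ∪ T₂, 2 ≤ (X a).card →
        r + (commonColors (A a) (e a)).card ≤ (S.biUnion M).card := by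
      intro a ha h2
      have hXe : X a = {e a, e a + 1} :=
        Finset.eq_of_subset_of_card_le (hXT a ha) (Finset.card_le_two.trans h2)
      have hm1 := hsub _ ((hXmem a (e a)).mp (by simp [hXe]))
      have hm2 := hsub _ ((hXmem a (e a + 1)).mp (by simp [hXe]))
      have hM1 : M (Sum.inl (a, e a)) = A a (e a) := by simp [hM]
      have hM2 : M (Sum.inl (a, e a + 1)) = commonColors (A a) (e a) := by
        have : e a + 1 ≠ e a := by generalize e a = j; revert j; decide
        simp [hM, Finset.mem_union.mp ha, this]
      rw [hM1] at hm1
      rw [hM2] at hm2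
      have h := Finset.card_le_card (Finset.union_subset hm1 hm2)
      rw [Finset.card_union_of_disjoint (disjoint_commonColors (hdisj a (hTP ha)) _)] at h
      have := hA a (hTP ha) (e a)
      omega
    have hMA : ∀ a, a ∉ T₁ ∪ T₂ → ∀ i, M (Sum.inl (a, i)) = A a i := fun a ha i => by
      simp only [hM, Sum.elim_inl, ha, false_and, if_false]
    by_cases hc3 : ∃ a ∈ P, 3 ≤ (X a).card
    · obtain ⟨a, haP, ha⟩ := hc3
      have haT : a ∉ T₁ ∪ T₂ := fun h => by have := hXT2 a h; omega
      have hXu : X a = Finset.univ :=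
        Finset.eq_univ_of_card _ (le_antisymm (Finset.card_le_univ _) (by simpa using ha))
      have hm : ∀ i, A a i ⊆ S.biUnion M := fun i =>
        hMA a haT i ▸ hsub _ ((hXmem a i).mp (by simp [hXu]))
      have hU := Finset.card_le_card
        (Finset.union_subset (Finset.union_subset (hm 0) (hm 1)) (hm 2))
      have h4 := sum_card_le_card_add_card_commonColors (hdisj a haP)
      have h5 := (h₃ a haP haT).2
      have h6 := sum_add_card_le_mul hTP (fun a => (X a).card) 3 fun a _ => by
        split_ifs with h
        · have := hXT2 a h; omega
        · exact hX3 a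
      have := hA a haP 0
      have := hA a haP 1
      have := hA a haP 2
      omega
    have hX2 : ∀ a ∈ P, (X a).card ≤ 2 := fun a ha => by
      by_contra h
      exact hc3 ⟨a, ha, by omega⟩
    by_cases hc1 : ∃ a ∈ T₁, 2 ≤ (X a).card
    · obtain ⟨a, haT, ha⟩ := hc1
      have h4 := hdouble a (Finset.mem_union_left _ haT) ha
      have h5 := h₁ a haT
      have h6 := Finset.sum_le_card_nsmul P (fun a => (X a).card) 2 hX2
      rw [smul_eq_mul] at h6
      omega
    have hXT₁ : ∀ a ∈ T₁, (X a).card ≤ 1 := fun a ha => by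
      by_contra h
      exact hc1 ⟨a, ha, by omega⟩
    by_cases hc0 : ∃ a ∈ P, a ∉ T₁ ∪ T₂ ∧ 2 ≤ (X a).card
    · obtain ⟨a, haP, haT, ha⟩ := hc0
      obtain ⟨i, hi, j, hj, hij⟩ := Finset.one_lt_card.mp (by omega : 1 < (X a).card)
      have hm : ∀ i ∈ X a, A a i ⊆ S.biUnion M := fun i hi =>
        hMA a haT i ▸ hsub _ ((hXmem a i).mp hi)
      have hU := Finset.card_le_card (Finset.union_subset (hm i hi) (hm j hj))
      have h4 := Finset.card_union_add_card_inter (A a i) (A a j)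
      obtain ⟨l, hl⟩ := inter_eq_commonColors (A a) hij
      rw [hl] at h4
      have h5 := (h₃ a haP haT).1 l
      have h6 := sum_add_card_le_mul hT₁ (fun a => (X a).card) 2 fun a ha => by
        split_ifs with h
        · have := hXT₁ a h; omega
        · exact hX2 a ha
      have := hA a haP i
      have := hA a haP j
      omega
    have hX1 : ∀ a ∈ P, a ∉ T₂ → (X a).card ≤ 1 := fun a ha haT => by
      by_cases h1 : a ∈ T₁
      · exact hXT₁ a h1
      · by_contra h
        exact hc0 ⟨a, ha, by simp [h1, haT], by omega⟩
    by_cases hc2 : ∃ a ∈ T₂, 2 ≤ (X a).card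
    · obtain ⟨a, haT, ha⟩ := hc2
      have h4 := hdouble a (Finset.mem_union_right _ haT) ha
      have h5 := h₂ a haT
      have h6 := sum_le_mul_add_card hT₂ (fun a => (X a).card) 1 fun a ha => by
        split_ifs with h
        · exact hX2 a ha
        · exact hX1 a ha h
      omega
    by_cases hr' : ∃ x ∈ S, r ≤ (M x).card
    · obtain ⟨x, hx, hxr⟩ := hr'
      have h4 := Finset.card_le_card (hsub x hx)
      have h6 := Finset.sum_le_card_nsmul P (fun a => (X a).card) 1 fun a ha => by
        by_cases h : a ∈ T₂
        · by_contra h'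
          exact hc2 ⟨a, h, by omega⟩
        · exact hX1 a ha h
      rw [smul_eq_mul] at h6
      omega
    push Not at hr'
    have hform : ∀ x ∈ S, ∃ a ∈ T₁ ∪ T₂, x = Sum.inl (a, e a + 1) ∧
        M x = commonColors (A a) (e a) := by
      rintro (⟨a, i⟩ | b) hx
      · have hv := hS _ hx _ rfl
        by_cases h : a ∈ T₁ ∪ T₂ ∧ i ≠ e a
        · have h' := hv.2 h.1
          have key : ∀ i j : Fin 3, i ≠ j + 2 → i ≠ j → i = j + 1 := by decide
          have hi := key _ _ h' h.2
          refine ⟨a, h.1, by rw [show i = e a + 1 from hi], ?_⟩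
          simp only [hM, Sum.elim_inl]
          rw [if_pos h]
        · have h' := hr' _ hx
          simp only [hM, Sum.elim_inl] at h'
          rw [if_neg h] at h'
          exact absurd (hA a hv.1 i) (not_le.mpr h')
      · exact absurd (hB b) (not_le.mpr (hr' _ hx))
    refine Finset.card_le_card_of_injOn (fun x => Sum.elim (fun p => f p.1) (fun _ => default) x)
      ?_ ?_
    · intro x hx
      obtain ⟨a, ha, rfl, hMx⟩ := hform x hx
      exact hsub _ hx (hMx ▸ hfe a ha)
    · intro x hx y hy hxy
      obtain ⟨a, ha, rfl, -⟩ := hform x hx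
      obtain ⟨b, hb, rfl, -⟩ := hform y hy
      rw [hinj (Finset.mem_coe.mpr ha) (Finset.mem_coe.mpr hb) hxy]
  obtain ⟨φ, hφ, hφM⟩ := (Finset.all_card_le_biUnion_card_iff_exists_injective
    (fun x : {x // valid x} => M x)).mp fun S => by
      have h := hall (S.map (Function.Embedding.subtype _)) fun x hx => by
        obtain ⟨y, -, rfl⟩ := Finset.mem_map.mp hx
        exact y.2
      rw [Finset.card_map, Finset.map_eq_image, Finset.image_biUnion] at h
      exact h
  set ψ : α × Fin 3 ⊕ β → γ := fun x => if h : valid x then φ ⟨x, h⟩ else default with hψ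
  have hψM : ∀ x, valid x → ψ x ∈ M x := fun x hx => by
    simp only [hψ, hx, dif_pos]
    exact hφM ⟨x, hx⟩
  have hψinj : ∀ x y, valid x → valid y → ψ x = ψ y → x = y := fun x y hx hy h => by
    simp only [hψ, hx, hy, dif_pos] at h
    exact congrArg Subtype.val (hφ h)
  -- The map `ρ` sends a vertex that was merged away to the vertex representing its pair.
  set ρ : α → Fin 3 → α × Fin 3 :=
    fun a i => (a, if a ∈ T₁ ∪ T₂ ∧ i = e a + 2 then e a + 1 else i) with hρ
  have hvinr : ∀ b, valid (Sum.inr b) := fun b p h => by cases h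
  have hvρ : ∀ a ∈ P, ∀ i, valid (Sum.inl (ρ a i)) := by
    rintro a ha i p ⟨⟩
    refine ⟨ha, fun hT => ?_⟩
    change (if a ∈ T₁ ∪ T₂ ∧ i = e a + 2 then e a + 1 else i) ≠ e a + 2
    split_ifs with h
    · generalize e a = j; revert j; decide
    · exact fun h' => h ⟨hT, h'⟩
  refine ⟨fun a i => ψ (Sum.inl (ρ a i)), fun b => ψ (Sum.inr b), ?_,
    fun b => hψM _ (hvinr b), ?_, ?_, ?_⟩
  · intro a ha i
    have h := hψM _ (hvρ a ha i)
    change ψ (Sum.inl (ρ a i)) ∈ A a i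
    by_cases h1 : a ∈ T₁ ∪ T₂ ∧ i = e a + 2
    · have hne : e a + 1 ≠ e a := by generalize e a = j; revert j; decide
      have hMρ : M (Sum.inl (ρ a i)) = commonColors (A a) (e a) := by
        simp only [hM, hρ, Sum.elim_inl]
        rw [if_pos h1, if_pos ⟨h1.1, hne⟩]
      rw [hMρ] at h
      exact h1.2 ▸ (Finset.mem_inter.mp h).2
    · have hρ' : ρ a i = (a, i) := by simp only [hρ]; rw [if_neg h1]
      rw [hρ'] at h ⊢
      by_cases h2 : a ∈ T₁ ∪ T₂ ∧ i ≠ e a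
      · have key : ∀ i j : Fin 3, i ≠ j + 2 → i ≠ j → i = j + 1 := by decide
        have hi := key i (e a) (fun h => h1 ⟨h2.1, h⟩) h2.2
        simp only [hM, Sum.elim_inl] at h
        rw [if_pos h2] at h
        have h3 := (Finset.mem_inter.mp h).1
        rwa [← hi] at h3
      · simp only [hM, Sum.elim_inl] at h
        rwa [if_neg h2] at h
  · intro a ha a' ha' hne i j h
    have := hψinj _ _ (hvρ a ha i) (hvρ a' ha' j) h
    exact hne (congrArg Prod.fst (Sum.inl.inj this))
  · intro b b' h
    exact Sum.inr.inj (hψinj _ _ (hvinr b) (hvinr b') h)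
  · intro a ha i b h
    cases hψinj _ _ (hvρ a ha i) (hvinr b) h

/-- **Kierstead's theorem**, as extended by Ohba: a complete multipartite graph all of whose
parts have three vertices or one vertex is colourable from lists of the size stated. -/
theorem exists_listColoring_completeMultipartite {β : Type*} [Fintype β] [DecidableEq β]
    [Inhabited γ] (P : Finset α) (r : ℕ) (A : α → Fin 3 → Finset γ) (B : β → Finset γ)
    (hA : ∀ a ∈ P, ∀ i, r ≤ (A a i).card) (hB : ∀ b, r ≤ (B b).card)
    (hrs : P.card + Fintype.card β ≤ r) (hr : 4 * P.card + 2 * Fintype.card β ≤ 3 * r + 1) :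
    ∃ (f : α → Fin 3 → γ) (g : β → γ), (∀ a ∈ P, ∀ i, f a i ∈ A a i) ∧ (∀ b, g b ∈ B b) ∧
      (∀ a ∈ P, ∀ a' ∈ P, a ≠ a' → ∀ i j, f a i ≠ f a' j) ∧ Function.Injective g ∧
      ∀ a ∈ P, ∀ i b, f a i ≠ g b := by
  induction h : P.card generalizing P r A B with
  | zero =>
    refine exists_listColoring_of_inter_eq_empty P r A B hA hB hrs hr ?_
    simp [Finset.card_eq_zero.mp h]
  | succ m ih =>
    by_cases hd : ∀ a ∈ P, A a 0 ∩ A a 1 ∩ A a 2 = ∅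
    · exact exists_listColoring_of_inter_eq_empty P r A B hA hB hrs hr hd
    -- A colour common to a whole part is spent on that part and deleted elsewhere. Both k and r
    -- drop by one, which preserves the two inequalities.
    push Not at hd
    obtain ⟨a₀, ha₀, c, hc⟩ := hd
    have hc' : ∀ i, c ∈ A a₀ i := by
      simp only [Finset.mem_inter] at hc
      intro i
      fin_cases i
      exacts [hc.1.1, hc.1.2, hc.2]
    have hcard := Finset.card_erase_of_mem ha₀
    have herase : ∀ X : Finset γ, r ≤ X.card → r - 1 ≤ (X.erase c).card := fun X hX => by
      have := Finset.pred_card_le_card_erase (s := X) (a := c)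
      omega
    obtain ⟨f, g, hf, hg, hff, hgg, hfg⟩ := ih (P.erase a₀) (r - 1)
      (fun a i => (A a i).erase c) (fun b => (B b).erase c)
      (fun a ha i => herase _ (hA a (Finset.mem_of_mem_erase ha) i)) (fun b => herase _ (hB b))
      (by omega) (by omega) (by omega)
    refine ⟨fun a i => if a = a₀ then c else f a i, g, ?_,
      fun b => Finset.mem_of_mem_erase (hg b), ?_, hgg, ?_⟩
    · intro a ha i
      by_cases h : a = a₀
      · subst h
        simpa using hc' i
      · simpa [h] using Finset.mem_of_mem_erase (hf a (Finset.mem_erase.mpr ⟨h, ha⟩) i)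
    · intro a ha a' ha' hne i j
      by_cases h : a = a₀ <;> by_cases h' : a' = a₀
      · exact absurd (h.trans h'.symm) hne
      · simpa [h, h'] using
          (Finset.ne_of_mem_erase (hf a' (Finset.mem_erase.mpr ⟨h', ha'⟩) j)).symm
      · simpa [h, h'] using Finset.ne_of_mem_erase (hf a (Finset.mem_erase.mpr ⟨h, ha⟩) i)
      · simpa [h, h'] using hff a (Finset.mem_erase.mpr ⟨h, ha⟩) a'
          (Finset.mem_erase.mpr ⟨h', ha'⟩) hne i j
    · intro a ha i b
      by_cases h : a = a₀
      · simpa [h] using (Finset.ne_of_mem_erase (hg b)).symm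
      · simpa [h] using hfg a (Finset.mem_erase.mpr ⟨h, ha⟩) i b

end

/-! ### List colouring of the far graph in general, and of paths and cycles. -/

theorem cycleFar_listColoring_of_le {n k s r : ℕ} (hn : n = 3 * k + s) (hrs : k + s ≤ r)
    (hr : 4 * k + 2 * s ≤ 3 * r + 1) (L : Fin n → Finset ℕ) (hL : ∀ i, r ≤ (L i).card) :
    ∃ f : Fin n → ℕ, (∀ i, f i ∈ L i) ∧ ∀ i j, CycleFar i j → f i ≠ f j := by
  obtain ⟨f, g, hf, hg, hff, hgg, hfg⟩ := exists_listColoring_completeMultipartite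
    (Finset.univ : Finset (Fin k)) r
    (fun b i => L ⟨3 * b.val + i.val, by omega⟩) (fun j : Fin s => L ⟨3 * k + j.val, by omega⟩)
    (fun b _ i => hL _) (fun j => hL _) (by simpa using hrs) (by simpa using hr)
  refine ⟨fun i => if h : i.val / 3 < k then f ⟨i.val / 3, h⟩ ⟨i.val % 3, by omega⟩
    else g ⟨i.val - 3 * k, by omega⟩, fun i => ?_, fun i j hij => ?_⟩
  · by_cases h : i.val / 3 < k
    · simp only [h, dif_pos]
      convert hf ⟨i.val / 3, h⟩ (Finset.mem_univ _) ⟨i.val % 3, by omega⟩ using 3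
      change i.val = 3 * (i.val / 3) + i.val % 3
      omega
    · simp only [h, dif_neg, not_false_eq_true]
      convert hg ⟨i.val - 3 * k, by omega⟩ using 3
      change i.val = 3 * k + (i.val - 3 * k)
      omega
  · unfold CycleFar at hij
    by_cases h : i.val / 3 < k <;> by_cases h' : j.val / 3 < k <;>
      simp only [h, h', dif_pos, dif_neg, not_false_eq_true]
    · refine hff _ (Finset.mem_univ _) _ (Finset.mem_univ _) (fun h => ?_) _ _
      rw [Fin.mk.injEq] at h
      omega
    · exact hfg _ (Finset.mem_univ _) _ _
    · exact (hfg _ (Finset.mem_univ _) _ _).symm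
    · intro h
      have := hgg h
      rw [Fin.mk.injEq] at this
      omega

/-- The cyclic successor. -/
def cycleNext {n : ℕ} (i : Fin n) : Fin n :=
  ⟨if i.val + 1 < n then i.val + 1 else 0, by have := i.2; split_ifs <;> omega⟩

theorem cycleNext_val {n : ℕ} (i : Fin n) :
    (i.val + 1 < n ∧ (cycleNext i).val = i.val + 1) ∨
      (i.val + 1 = n ∧ (cycleNext i).val = 0) := by
  unfold cycleNext
  by_cases h : i.val + 1 < n
  · left; simp [h]
  · exact Or.inr ⟨by omega, by simp [h]⟩

theorem exists_path_listColoring {n : ℕ} (L : Fin n → Finset ℕ) (i₀ : Fin n) (hi₀ : i₀.val = 0)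
    (hL : ∀ i, i ≠ i₀ → 2 ≤ (L i).card) (x : ℕ) (hx : x ∈ L i₀) :
    ∃ f : Fin n → ℕ, (∀ i, f i ∈ L i) ∧ f i₀ = x ∧
      ∀ i, i.val + 1 < n → f i ≠ f (cycleNext i) := by
  have hpick : ∀ (i : Fin n) (y : ℕ), ∃ z, i ≠ i₀ → z ∈ L i ∧ z ≠ y := fun i y => by
    by_cases h : i = i₀
    · exact ⟨0, fun h' => absurd h h'⟩
    · obtain ⟨z, hz, hz'⟩ := Finset.exists_mem_ne (hL i h) y
      exact ⟨z, fun _ => ⟨hz, hz'⟩⟩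
  choose pick hpick using hpick
  set b : ℕ → ℕ := fun m => Nat.rec x
    (fun i y => if h : i + 1 < n then pick ⟨i + 1, h⟩ y else 0) m with hb
  have hsucc : ∀ i (h : i + 1 < n), b (i + 1) ∈ L ⟨i + 1, h⟩ ∧ b (i + 1) ≠ b i := fun i h => by
    have h1 : b (i + 1) = pick ⟨i + 1, h⟩ (b i) := by simp [hb, h]
    rw [h1]
    exact hpick _ _ fun h2 => by simp [← h2] at hi₀
  refine ⟨fun i => b i, fun ⟨i, hi⟩ => ?_, by simp [hb, hi₀], fun i hi => ?_⟩
  · cases i with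
    | zero =>
      have h0 : i₀ = ⟨0, hi⟩ := Fin.ext hi₀
      rw [h0] at hx
      exact hx
    | succ i => exact (hsucc i hi).1
  · rcases cycleNext_val i with h | h
    · simp only [h.2]
      exact (hsucc i hi).2.symm
    · omega

theorem exists_cycle_listColoring {n : ℕ} (hn : 2 ≤ n) (L : Fin n → Finset ℕ)
    (hL : ∀ i, 3 ≤ (L i).card) :
    ∃ f : Fin n → ℕ, (∀ i, f i ∈ L i) ∧ ∀ i, f i ≠ f (cycleNext i) := by
  set i₀ : Fin n := ⟨0, by omega⟩ with hi₀
  obtain ⟨x, hx⟩ : (L i₀).Nonempty := Finset.card_pos.mp (by have := hL i₀; omega)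
  obtain ⟨f, hf, hf₀, hf'⟩ := exists_path_listColoring
    -- Removing the colour `x` of the first vertex from all other lists leaves two colours each for
    -- the greedy choice and makes the closing edge proper.
    (fun i : Fin n => if i = i₀ then L i else (L i).erase x) i₀ rfl (by
      intro i hi
      have := Finset.pred_card_le_card_erase (s := L i) (a := x)
      have := hL i
      simp only [hi, if_false]
      omega) x (by simpa using hx)
  refine ⟨f, fun i => ?_, fun i => ?_⟩
  · have := hf i
    split_ifs at this
    exacts [this, Finset.mem_of_mem_erase this]
  · rcases cycleNext_val i with h | h
    · exact hf' i h.1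
    · have h0 : cycleNext i = i₀ := Fin.ext h.2
      have hi : i ≠ i₀ := fun hi => by
        rw [hi] at h
        simp only [hi₀] at h
        omega
      have := hf i
      simp only [hi, if_false] at this
      rw [h0, hf₀]
      exact Finset.ne_of_mem_erase this

/-! ### Rainbow geodesics of length two. -/

section
variable {V : Type*} {G : SimpleGraph V}

theorem exists_rainbow_geodesic_of_adj_adj {x z y : V} (hxz : G.Adj x z) (hzy : G.Adj z y)
    (hne : x ≠ y) (hxy : ¬ G.Adj x y) {c : G.edgeSet → ℕ} {e f : G.edgeSet}
    (he : e.1 = s(x, z)) (hf : f.1 = s(z, y)) (hc : c e ≠ c f) :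
    ∃ p : G.Walk x y, IsGeodesic p ∧ IsRainbow c p := by
  refine ⟨.cons hxz (.cons hzy .nil), ⟨?_, ?_⟩, ?_⟩
  · simp [SimpleGraph.Walk.isPath_def, hxz.ne, hzy.ne, hne]
  · have h1 := SimpleGraph.dist_le (SimpleGraph.Walk.cons hxz (.cons hzy .nil))
    have hr : G.Reachable x y := ⟨.cons hxz (.cons hzy .nil)⟩
    have h2 := hr.pos_dist_of_ne hne
    have h3 : G.dist x y ≠ 1 := fun h => hxy (SimpleGraph.dist_eq_one_iff_adj.mp h)
    simp only [SimpleGraph.Walk.length_cons, SimpleGraph.Walk.length_nil] at h1 ⊢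
    omega
  · intro e' f' he' hf' hne'
    have key : ∀ g : G.edgeSet, g.1 ∈ (SimpleGraph.Walk.cons hxz (.cons hzy .nil)).edges →
        g = e ∨ g = f := fun g hg => by
      simp only [SimpleGraph.Walk.edges_cons, SimpleGraph.Walk.edges_nil, List.mem_cons,
        List.not_mem_nil, or_false] at hg
      rcases hg with h | h
      · exact Or.inl (Subtype.ext (h.trans he.symm))
      · exact Or.inr (Subtype.ext (h.trans hf.symm))
    rcases key e' he' with rfl | rfl <;> rcases key f' hf' with rfl | rfl
    exacts [absurd rfl hne', hc, hc.symm, absurd rfl hne']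

theorem stronglyRainbowConnected_of_not_adj {c : G.edgeSet → ℕ}
    (h : ∀ x y, x ≠ y → ¬ G.Adj x y → ∃ p : G.Walk x y, IsGeodesic p ∧ IsRainbow c p) :
    StronglyRainbowConnected G c := by
  intro x y
  by_cases hxy : x = y
  · subst hxy
    exact ⟨.nil, ⟨by simp, by simp⟩, fun e f he => by simp at he⟩
  by_cases hadj : G.Adj x y
  · refine ⟨.cons hadj .nil, ⟨by simp [SimpleGraph.Walk.isPath_def, hxy], ?_⟩, ?_⟩
    · simp [SimpleGraph.dist_eq_one_iff_adj.mpr hadj]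
    · intro e f he hf hne
      simp only [SimpleGraph.Walk.edges_cons, SimpleGraph.Walk.edges_nil, List.mem_cons,
        List.not_mem_nil, or_false] at he hf
      exact absurd (Subtype.ext (he.trans hf.symm)) hne
  · exact h x y hxy hadj

theorem StronglyRainbowConnected.exists_ne_of_common_neighbor {c : G.edgeSet → ℕ}
    (hc : StronglyRainbowConnected G c) {x y w : V} (hne : x ≠ y) (hxy : ¬ G.Adj x y)
    (hxw : G.Adj x w) (hwy : G.Adj w y) :
    ∃ (z : V) (h : G.Adj x z) (h' : G.Adj z y), c ⟨s(x, z), h⟩ ≠ c ⟨s(z, y), h'⟩ := by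
  obtain ⟨p, ⟨hp, hlen⟩, hrain⟩ := hc x y
  have hd := SimpleGraph.dist_le (SimpleGraph.Walk.cons hxw (.cons hwy .nil))
  rw [← hlen] at hd
  match p, hp, hrain, hd with
  | .nil, _, _, _ => exact absurd rfl hne
  | .cons h .nil, _, _, _ => exact absurd h hxy
  | .cons (v := z) h (.cons h' .nil), hp, hrain, _ =>
    refine ⟨z, h, h', hrain _ _ (by simp) (by simp) fun heq => ?_⟩
    have := Subtype.mk.inj heq
    rw [Sym2.eq_swap, Sym2.eq_iff] at this
    rcases this with h1 | h1
    · exact hne h1.2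
    · exact h.ne h1.2
  | .cons _ (.cons _ (.cons _ q)), _, _, hd =>
    simp only [SimpleGraph.Walk.length_cons, SimpleGraph.Walk.length_nil] at hd
    omega

end

/-! ### From spoke and rim colours to colourings of the wheel. -/

theorem cycleGraph_adj_iff_val {n : ℕ} (hn : 2 ≤ n) (i j : Fin n) :
    (SimpleGraph.cycleGraph n).Adj i j ↔ j = cycleNext i ∨ i = cycleNext j := by
  rw [SimpleGraph.cycleGraph_adj', Fin.ext_iff, Fin.ext_iff]
  have hi := i.2
  have hj := j.2
  have key : ∀ i j : Fin n, (i - j).val = 1 ↔ i.val = (cycleNext j).val := fun i j => by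
    have hi := i.2
    have hj := j.2
    rw [Fin.sub_def]
    have h := cycleNext_val j
    change (n - j.val + i.val) % n = 1 ↔ _
    by_cases hlt : j.val ≤ i.val
    · rw [show n - j.val + i.val = (i.val - j.val) + n by omega, Nat.add_mod_right,
        Nat.mod_eq_of_lt (by omega)]
      omega
    · rw [Nat.mod_eq_of_lt (by omega)]
      omega
  rw [key, key, or_comm]

/-- The edge from the hub to the `i`-th vertex of the cycle. -/
def wheelSpoke {n : ℕ} (i : Fin n) : (wheelGraph n).edgeSet :=
  ⟨s(none, some i), trivial⟩

theorem wheelGraph_adj_some {n : ℕ} (hn : 2 ≤ n) (i j : Fin n) :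
    (wheelGraph n).Adj (some i) (some j) ↔ j = cycleNext i ∨ i = cycleNext j :=
  cycleGraph_adj_iff_val hn i j

/-- The edge from the `i`-th vertex of the cycle to the next one. -/
def wheelRim {n : ℕ} (hn : 2 ≤ n) (i : Fin n) : (wheelGraph n).edgeSet :=
  ⟨s(some i, some (cycleNext i)), (wheelGraph_adj_some hn _ _).mpr (Or.inl rfl)⟩

/-- This allows spokes and rim edges to be coloured independently. For n = 2 the two rim edges would
coincide. -/
theorem wheelEdge_injective {n : ℕ} (hn : 3 ≤ n) :
    Function.Injective (Sum.elim wheelSpoke (wheelRim (n := n) (by omega))) := by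
  rintro (i | i) (j | j) h <;> have h' := congrArg Subtype.val h <;>
    simp only [Sum.elim_inl, Sum.elim_inr, wheelSpoke, wheelRim, Sym2.eq_iff, reduceCtorEq,
      Option.some.injEq, and_false, false_and, or_false, true_and] at h'
  · rw [h']
  · rcases h' with h' | h'
    · rw [h'.1]
    · have h1 := cycleNext_val i
      have h2 := cycleNext_val j
      rw [h'.2] at h1
      rw [← h'.1] at h2
      omega

/-- Colours for the spokes and the rim of a wheel extend to a list colouring. -/
theorem exists_wheel_listColoring {n : ℕ} (hn : 3 ≤ n) (L : (wheelGraph n).edgeSet → Set ℕ)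
    (hL : ∀ e, (L e).Nonempty) (a b : Fin n → ℕ) (ha : ∀ i, a i ∈ L (wheelSpoke i))
    (hb : ∀ i, b i ∈ L (wheelRim (by omega) i)) :
    ∃ c : (wheelGraph n).edgeSet → ℕ, (∀ e, c e ∈ L e) ∧ (∀ i, c (wheelSpoke i) = a i) ∧
      ∀ i, c (wheelRim (by omega) i) = b i := by
  have hinj := wheelEdge_injective hn
  set c := Function.extend (Sum.elim wheelSpoke (wheelRim (n := n) (by omega))) (Sum.elim a b)
    fun e => (hL e).choose with hc
  have ha' : ∀ i, c (wheelSpoke i) = a i := fun i => hinj.extend_apply _ _ (Sum.inl i)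
  have hb' : ∀ i, c (wheelRim (by omega) i) = b i := fun i => hinj.extend_apply _ _ (Sum.inr i)
  refine ⟨c, fun e => ?_, ha', hb'⟩
  by_cases he : ∃ x, Sum.elim wheelSpoke (wheelRim (n := n) (by omega)) x = e
  · obtain ⟨i | i, rfl⟩ := he
    · exact (ha' i).symm ▸ ha i
    · exact (hb' i).symm ▸ hb i
  · rw [hc, Function.extend_apply' _ _ _ he]
    exact (hL e).choose_spec

theorem wheel_stronglyRainbowConnected {n : ℕ} (hn : 3 ≤ n) (c : (wheelGraph n).edgeSet → ℕ)
    (hfar : ∀ i j : Fin n, CycleFar i j → c (wheelSpoke i) ≠ c (wheelSpoke j))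
    (hnear : ∀ i : Fin n,
      c (wheelRim (by omega) i) ≠ c (wheelRim (by omega) (cycleNext i)) ∨
        c (wheelSpoke i) ≠ c (wheelSpoke (cycleNext (cycleNext i)))) :
    StronglyRainbowConnected (wheelGraph n) c := by
  refine stronglyRainbowConnected_of_not_adj ?_
  have hspoke : ∀ i j : Fin n, i ≠ j → ¬ (wheelGraph n).Adj (some i) (some j) →
      c (wheelSpoke i) ≠ c (wheelSpoke j) →
      ∃ p : (wheelGraph n).Walk (some i) (some j), IsGeodesic p ∧ IsRainbow c p :=
    fun i j hij hadj h => exists_rainbow_geodesic_of_adj_adj (z := none) trivial trivial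
      (by simpa using hij) hadj Sym2.eq_swap rfl h
  rintro (_ | i) (_ | j) hne hadj
  · exact absurd rfl hne
  · exact absurd trivial hadj
  · exact absurd trivial hadj
  have hij : i ≠ j := fun h => hne (congrArg some h)
  have hrim : ∀ m : Fin n, (wheelGraph n).Adj (some m) (some (cycleNext m)) := fun m =>
    (wheelRim (by omega) m).2
  by_cases hf : CycleFar i j
  · exact hspoke i j hij hadj (hfar i j hf)
  have hadj' := hadj
  rw [wheelGraph_adj_some (by omega), not_or, Fin.ext_iff, Fin.ext_iff] at hadj'
  have h1 := cycleNext_val i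
  have h2 := cycleNext_val (cycleNext i)
  have h3 := cycleNext_val j
  have h4 := cycleNext_val (cycleNext j)
  have hv : i.val ≠ j.val := fun h => hij (Fin.ext h)
  have hnn : j = cycleNext (cycleNext i) ∨ i = cycleNext (cycleNext j) := by
    unfold CycleFar at hf
    rw [Fin.ext_iff, Fin.ext_iff]
    have := i.2
    have := j.2
    omega
  rcases hnn with rfl | rfl
  · rcases hnear i with h | h
    · exact exists_rainbow_geodesic_of_adj_adj (hrim _) (hrim _) hne hadj rfl rfl h
    · exact hspoke _ _ hij hadj h
  · rcases hnear j with h | h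
    · exact exists_rainbow_geodesic_of_adj_adj (hrim _).symm (hrim _).symm hne hadj
        Sym2.eq_swap Sym2.eq_swap h.symm
    · exact hspoke _ _ hij hadj h.symm

theorem stronglyRainbowChoosable_wheelGraph {n r : ℕ} (hn : 3 ≤ n) (hr : 1 ≤ r)
    (h : ∀ A B : Fin n → Finset ℕ, (∀ i, r ≤ (A i).card) → (∀ i, r ≤ (B i).card) →
      ∃ a b : Fin n → ℕ, (∀ i, a i ∈ A i) ∧ (∀ i, b i ∈ B i) ∧
        (∀ i j, CycleFar i j → a i ≠ a j) ∧
        ∀ i, b i ≠ b (cycleNext i) ∨ a i ≠ a (cycleNext (cycleNext i))) :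
    StronglyRainbowChoosable (wheelGraph n) r := by
  intro L hL
  have hfin : ∀ e, ∃ t : Finset ℕ, (t : Set ℕ) ⊆ L e ∧ r ≤ t.card := fun e => by
    obtain ⟨t, ht, htr⟩ := Set.exists_subset_encard_eq (hL e)
    have htf : t.Finite := Set.finite_of_encard_eq_coe htr
    refine ⟨htf.toFinset, by simpa using ht, ?_⟩
    rw [htf.encard_eq_coe_toFinset_card] at htr
    exact (by exact_mod_cast htr.ge)
  choose t ht htr using hfin
  obtain ⟨a, b, ha, hb, hfar, hnear⟩ := h (fun i => t (wheelSpoke i))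
    (fun i => t (wheelRim (by omega) i)) (fun i => htr _) (fun i => htr _)
  obtain ⟨c, hc, hca, hcb⟩ := exists_wheel_listColoring hn L
    (fun e => (Finset.card_pos.mp (hr.trans (htr e))).to_set.mono (ht e)) a b
    (fun i => ht _ (ha i)) (fun i => ht _ (hb i))
  exact ⟨c, hc, wheel_stronglyRainbowConnected hn c (by simpa only [hca] using hfar)
    (by simpa only [hca, hcb] using hnear)⟩

theorem stronglyRainbowChoosable_wheelGraph_of_cycleFar {n r : ℕ} (hn : 3 ≤ n) (hr : 3 ≤ r)
    (h : ∀ A : Fin n → Finset ℕ, (∀ i, r ≤ (A i).card) →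
      ∃ a : Fin n → ℕ, (∀ i, a i ∈ A i) ∧ ∀ i j, CycleFar i j → a i ≠ a j) :
    StronglyRainbowChoosable (wheelGraph n) r := by
  refine stronglyRainbowChoosable_wheelGraph hn (by omega) fun A B hA hB => ?_
  obtain ⟨a, ha, ha'⟩ := h A hA
  obtain ⟨b, hb, hb'⟩ := exists_cycle_listColoring (by omega) B fun i => hr.trans (hB i)
  exact ⟨a, b, ha, hb, ha', fun i => Or.inl (hb' i)⟩

theorem stronglyRainbowChoosable_wheelGraph_two {n : ℕ} (hn : 3 ≤ n)
    (h : ∀ A : Fin n → Finset ℕ, (∀ i, 2 ≤ (A i).card) →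
      ∃ a : Fin n → ℕ, (∀ i, a i ∈ A i) ∧ (∀ i j, CycleFar i j → a i ≠ a j) ∧
        a ⟨n - 1, by omega⟩ ≠ a ⟨1, by omega⟩) :
    StronglyRainbowChoosable (wheelGraph n) 2 := by
  refine stronglyRainbowChoosable_wheelGraph hn (by omega) fun A B hA hB => ?_
  obtain ⟨a, ha, ha', hlast⟩ := h A hA
  set i₀ : Fin n := ⟨0, by omega⟩ with hi₀
  obtain ⟨x, hx⟩ : (B i₀).Nonempty := Finset.card_pos.mp (by have := hB i₀; omega)
  obtain ⟨b, hb, -, hb'⟩ := exists_path_listColoring B i₀ rfl (fun i _ => hB i) x hx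
  refine ⟨a, b, ha, hb, ha', fun i => ?_⟩
  by_cases hi : i.val + 1 < n
  · exact Or.inl (hb' i hi)
  -- The path colouring does not control the last rim edge against the first. They form the rim
  -- route from n - 1 to 1, so here the spokes of these two vertices must differ.
  · right
    have h1 := cycleNext_val i
    have h2 := cycleNext_val (cycleNext i)
    have hi' : i = ⟨n - 1, by omega⟩ := Fin.ext (by simp only; omega)
    have hj : cycleNext (cycleNext i) = ⟨1, by omega⟩ := Fin.ext (by simp only; omega)
    rw [hj]
    exact fun heq => hlast ((congrArg a hi').symm.trans heq)

theorem stronglyRainbowChoosable_wheelGraph_three :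
    StronglyRainbowChoosable (wheelGraph 3) 1 := by
  intro L hL
  choose c hc using fun e => Set.one_le_encard_iff_nonempty.mp (by simpa using hL e)
  refine ⟨c, hc, stronglyRainbowConnected_of_not_adj ?_⟩
  rintro (_ | i) (_ | j) hne hadj
  · exact absurd rfl hne
  · exact absurd trivial hadj
  · exact absurd trivial hadj
  · rw [wheelGraph_adj_some (by omega)] at hadj
    have h : ∀ i j : Fin 3, i ≠ j → j = cycleNext i ∨ i = cycleNext j := by decide
    exact absurd (h i j fun h => hne (congrArg some h)) hadj

theorem stronglyRainbowChoosable_wheelGraph_small {n : ℕ} (hn : n = 4 ∨ n = 5 ∨ n = 6) :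
    StronglyRainbowChoosable (wheelGraph n) 2 := by
  refine stronglyRainbowChoosable_wheelGraph_two (by omega) fun A hA => ?_
  -- `pick i x` avoids `x`; the argument 0 stands for no constraint. For n = 6 the constraints are
  -- the three antipodal pairs and the pair 5, 1. They form the path 4, 1, 5, 2 and the edge 0, 3, a
  -- forest that is coloured greedily.
  choose pick hpick hpick' using fun i (x : ℕ) => Finset.exists_mem_ne (hA i) x
  rcases hn with rfl | rfl | rfl
  · refine ⟨![pick 0 0, pick 1 0, pick 2 0, pick 3 (pick 1 0)], ?_, ?_, ?_⟩
    · intro i; fin_cases i <;> exact hpick _ _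
    · intro i j h; exfalso; revert i j; decide
    · exact hpick' _ _
  · refine ⟨![pick 0 0, pick 1 0, pick 2 0, pick 3 0, pick 4 (pick 1 0)], ?_, ?_, ?_⟩
    · intro i; fin_cases i <;> exact hpick _ _
    · intro i j h; exfalso; revert i j; decide
    · exact hpick' _ _
  · refine ⟨![pick 0 (pick 3 0), pick 1 0, pick 2 (pick 5 (pick 1 0)), pick 3 0,
      pick 4 (pick 1 0), pick 5 (pick 1 0)], ?_, ?_, ?_⟩
    · intro i; fin_cases i <;> exact hpick _ _
    · have h : ∀ i j : Fin 6, CycleFar i j → (i, j) = (0, 3) ∨ (i, j) = (3, 0) ∨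
        (i, j) = (1, 4) ∨ (i, j) = (4, 1) ∨ (i, j) = (2, 5) ∨ (i, j) = (5, 2) := by decide
      intro i j hij
      rcases h i j hij with h | h | h | h | h | h <;> obtain ⟨rfl, rfl⟩ := Prod.mk.inj h <;>
        first | exact hpick' _ _ | exact (hpick' _ _).symm
    · exact hpick' _ _

/-! ### Lower bounds from constant lists. -/

theorem two_le_of_stronglyRainbowChoosable_wheelGraph {n r : ℕ} (hn : 4 ≤ n) (hr : 1 ≤ r)
    (h : StronglyRainbowChoosable (wheelGraph n) r) : 2 ≤ r := by
  by_contra hr2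
  obtain rfl : r = 1 := by omega
  obtain ⟨c, hc, hsrc⟩ := h (fun _ => {0}) (by simp)
  obtain ⟨z, h1, h2, hne⟩ := hsrc.exists_ne_of_common_neighbor
    (x := some ⟨0, by omega⟩) (y := some ⟨2, by omega⟩) (w := none) (by simp) (by
      rw [wheelGraph_adj_some (by omega), Fin.ext_iff, Fin.ext_iff]
      have := cycleNext_val (⟨0, by omega⟩ : Fin n)
      have := cycleNext_val (⟨2, by omega⟩ : Fin n)
      simp only at *
      omega) trivial trivial
  exact hne ((hc _).trans (hc _).symm)

theorem spoke_ne_of_cycleFar {n : ℕ} {c : (wheelGraph n).edgeSet → ℕ}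
    (hc : StronglyRainbowConnected (wheelGraph n) c) {i j : Fin n}
    (hij : i.val + 3 ≤ j.val ∧ j.val + 3 ≤ i.val + n) :
    c (wheelSpoke i) ≠ c (wheelSpoke j) := by
  have hn : 2 ≤ n := by omega
  have hi := cycleNext_val i
  have hj := cycleNext_val j
  obtain ⟨z, h1, h2, hne⟩ := hc.exists_ne_of_common_neighbor
    (x := some i) (y := some j) (w := none) (by
      rw [ne_eq, Option.some.injEq, Fin.ext_iff]; omega) (by
      rw [wheelGraph_adj_some hn, Fin.ext_iff, Fin.ext_iff]
      omega) trivial trivial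
  match z with
  | none =>
    have he : wheelSpoke i = ⟨s(some i, none), h1⟩ := Subtype.ext Sym2.eq_swap
    rw [he]
    exact hne
  | some m =>
    exfalso
    have hm := cycleNext_val m
    rw [wheelGraph_adj_some hn, Fin.ext_iff, Fin.ext_iff] at h1 h2
    omega

theorem le_three_mul_of_stronglyRainbowChoosable_wheelGraph {n r : ℕ} (hn : 7 ≤ n)
    (h : StronglyRainbowChoosable (wheelGraph n) r) : n ≤ 3 * r := by
  obtain ⟨c, hc, hsrc⟩ := h (fun _ => (Finset.range r : Set ℕ)) (by
    intro e; rw [Set.encard_coe_eq_coe_finsetCard, Finset.card_range])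
  -- Four vertices contain a far pair. In cyclic order, opposite ones that are not far bound an arc
  -- of length exactly two; two such arcs overlap in three consecutive steps, whose ends are far.
  have h1 := Finset.card_le_mul_card_image (f := fun i : Fin n => c (wheelSpoke i))
    Finset.univ 3 (by
      intro x _
      by_contra hcard
      obtain ⟨F, hF, hF4⟩ := Finset.exists_subset_card_eq (not_le.mp hcard)
      have hmem : ∀ i, c (wheelSpoke (F.orderEmbOfFin hF4 i)) = x := fun i =>
        (Finset.mem_filter.mp (hF (F.orderEmbOfFin_mem hF4 i))).2
      have hlt : ∀ i j : Fin 4, i < j →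
          (F.orderEmbOfFin hF4 i).val < (F.orderEmbOfFin hF4 j).val := fun i j hij =>
        (F.orderEmbOfFin hF4).strictMono hij
      have hnot : ∀ i j : Fin 4, ¬ ((F.orderEmbOfFin hF4 i).val + 3 ≤ (F.orderEmbOfFin hF4 j).val ∧
          (F.orderEmbOfFin hF4 j).val + 3 ≤ (F.orderEmbOfFin hF4 i).val + n) := fun i j hij =>
        spoke_ne_of_cycleFar hsrc hij ((hmem i).trans (hmem j).symm)
      have h01 := hlt 0 1 (by decide)
      have h12 := hlt 1 2 (by decide)
      have h23 := hlt 2 3 (by decide)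
      have n01 := hnot 0 1
      have n02 := hnot 0 2
      have n03 := hnot 0 3
      have n12 := hnot 1 2
      have n13 := hnot 1 3
      have n23 := hnot 2 3
      have := (F.orderEmbOfFin hF4 3).2
      omega)
  have h2 : (Finset.univ.image fun i : Fin n => c (wheelSpoke i)) ⊆ Finset.range r := by
    intro x hx
    obtain ⟨i, -, rfl⟩ := Finset.mem_image.mp hx
    exact hc _
  have h3 := Finset.card_le_card h2
  rw [Finset.card_range] at h3
  rw [Finset.card_univ, Fintype.card_fin] at h1
  omega

/-! ### The values and bounds for wheels. -/

theorem stronglyRainbowChoosable_wheelGraph_of_le {n k s r : ℕ} (hn : n = 3 * k + s)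
    (hn3 : 3 ≤ n) (hr3 : 3 ≤ r) (hrs : k + s ≤ r) (hr : 4 * k + 2 * s ≤ 3 * r + 1) :
    StronglyRainbowChoosable (wheelGraph n) r :=
  stronglyRainbowChoosable_wheelGraph_of_cycleFar hn3 hr3 (cycleFar_listColoring_of_le hn hrs hr)

theorem listStrongRainbowNumber_eq {V : Type*} {G : SimpleGraph V} {r : ℕ} (hr : 1 ≤ r)
    (h : StronglyRainbowChoosable G r)
    (hmin : ∀ m, 1 ≤ m → StronglyRainbowChoosable G m → r ≤ m) :
    listStrongRainbowNumber G = r :=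
  IsLeast.csInf_eq ⟨⟨hr, h⟩, fun m hm => hmin m hm.1 hm.2⟩

/-- For n ≥ 10 and s ≤ 2 the condition k + s ≤ r follows from 4k + 2s - 1 ≤ 3r. The last two
conclusions record that the infimum is attained, which the lower bound needs. -/
theorem listStrongRainbowNumber_wheelGraph_le {n k s : ℕ} (hn : n = 3 * k + s) (hn10 : 10 ≤ n)
    (hs : s ≤ 2) (q : ℚ) (hq : (4 * k + 2 * s - 1 : ℚ) ≤ 3 * q) :
    (listStrongRainbowNumber (wheelGraph n) : ℤ) ≤ ⌈q⌉ ∧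
      1 ≤ listStrongRainbowNumber (wheelGraph n) ∧
      StronglyRainbowChoosable (wheelGraph n) (listStrongRainbowNumber (wheelGraph n)) := by
  have h1 : (4 * k + 2 * s - 1 : ℤ) ≤ 3 * ⌈q⌉ := by
    have := Int.le_ceil q
    have h2 : (4 * k + 2 * s - 1 : ℚ) ≤ 3 * (⌈q⌉ : ℚ) := by linarith
    exact_mod_cast h2
  obtain ⟨r, hr⟩ := Int.eq_ofNat_of_zero_le (by omega : 0 ≤ ⌈q⌉)
  have hmem : r ∈ {r : ℕ | 1 ≤ r ∧ StronglyRainbowChoosable (wheelGraph n) r} :=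
    ⟨by omega, stronglyRainbowChoosable_wheelGraph_of_le hn (by omega) (by omega) (by omega)
      (by omega)⟩
  refine ⟨?_, Nat.sInf_mem ⟨r, hmem⟩⟩
  rw [hr]
  exact_mod_cast Nat.sInf_le hmem

theorem mainTheorem9 :
    listStrongRainbowNumber (wheelGraph 3) = 1 ∧
    (∀ n : ℕ, n = 4 ∨ n = 5 ∨ n = 6 → listStrongRainbowNumber (wheelGraph n) = 2) ∧
    (∀ n : ℕ, n = 7 ∨ n = 8 ∨ n = 9 → listStrongRainbowNumber (wheelGraph n) = 3) ∧
    (∀ n : ℕ, 10 ≤ n →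
      ⌈(n : ℚ) / 3⌉ ≤ (listStrongRainbowNumber (wheelGraph n) : ℤ) ∧
      (n ≡ 0 [MOD 3] →
        (listStrongRainbowNumber (wheelGraph n) : ℤ) ≤ ⌈(4 * (n : ℚ) - 3) / 9⌉) ∧
      (n ≡ 1 [MOD 3] →
        (listStrongRainbowNumber (wheelGraph n) : ℤ) ≤ ⌈(4 * (n : ℚ) - 1) / 9⌉) ∧
      (n ≡ 2 [MOD 3] →
        (listStrongRainbowNumber (wheelGraph n) : ℤ) ≤ ⌈(4 * (n : ℚ) + 1) / 9⌉)) := by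
  refine ⟨listStrongRainbowNumber_eq le_rfl stronglyRainbowChoosable_wheelGraph_three
    fun m hm _ => hm, fun n hn => ?_, fun n hn => ?_, fun n hn => ⟨?_, ?_, ?_, ?_⟩⟩
  · exact listStrongRainbowNumber_eq (by omega) (stronglyRainbowChoosable_wheelGraph_small hn)
      fun m hm h => two_le_of_stronglyRainbowChoosable_wheelGraph (by omega) hm h
  · refine listStrongRainbowNumber_eq (by omega) ?_ fun m _ h => by
      have := le_three_mul_of_stronglyRainbowChoosable_wheelGraph (by omega) h
      omega
    rcases hn with rfl | rfl | rfl
    · exact stronglyRainbowChoosable_wheelGraph_of_le (k := 2) (s := 1) rfl (by omega) le_rfl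
        (by omega) (by omega)
    · exact stronglyRainbowChoosable_wheelGraph_of_cycleFar (by omega) le_rfl
        cycleFar_listColoring_eight
    · exact stronglyRainbowChoosable_wheelGraph_of_cycleFar (by omega) le_rfl
        cycleFar_listColoring_nine
  · obtain ⟨-, -, h⟩ := listStrongRainbowNumber_wheelGraph_le (n := n) (k := n / 3) (s := n % 3)
      (by omega) hn (by omega) ((4 * (n / 3 : ℕ) + 2 * (n % 3 : ℕ) - 1) / 3) (by linarith)
    have h1 := le_three_mul_of_stronglyRainbowChoosable_wheelGraph (by omega) h
    rw [Int.ceil_le, div_le_iff₀ (by norm_num), mul_comm]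
    exact_mod_cast h1
  all_goals
    intro hmod
    have hmod' : n % 3 = _ := hmod
    refine (listStrongRainbowNumber_wheelGraph_le (n := n) (k := n / 3) (s := n % 3)
      (by omega) hn (by omega) _ ?_).1
    -- With k = (n - s) / 3, the quantity (4k + 2s - 1) / 3 becomes the stated fraction for each
    -- residue s.
    have h1 : n = 3 * (n / 3) + n % 3 := by omega
    have h2 : (n : ℚ) = 3 * (n / 3 : ℕ) + (n % 3 : ℕ) := by exact_mod_cast h1
    rw [hmod'] at h2 ⊢
    norm_num at h2 ⊢
    linarith
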